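/- **Model.** Consider $C$ cells with one $M$-antenna base station (BS) each ($M\ge 1$) and $N_G$ copilot groups, each containing exactly one user per cell; user $(k,c)$ is the user of group $k$ in cell $c$. The channel from user $(k,c)$ to BS $l$ in slot $s=0,1,2,\dots$ is $g^{[l]}_{kc}(s)=\sqrt{\beta^{[l]}_{kc}}\,h^{[l]}_{kc}(s)\in\mathbb C^M$, with $\beta^{[l]}_{kc}>0$ and Gauss–Markov aging: $h^{[l]}_{kc}(0)\sim\mathcal{CN}(0,I_M)$ and $h^{[l]}_{kc}(s+1)=\rho^{[l]}_{kc}h^{[l]}_{kc}(s)+\varepsilon^{[l]}_{kc}(s+1)$, where $\rho^{[l]}_{kc}\in[-1,1]$ and $\varepsilon^{[l]}_{kc}(s)\sim\mathcal{CN}(0,(1-(\rho^{[l]}_{kc})^2)I_M)$. In slot $s$ a set $A(s)$ of groups is trained with orthonormal pilots $q_k(s)\in\mathbb C^{\tau}$, $k\in A(s)$ (so $|A(s)|\le\tau$), where $\tau\le T_s$ and $T_s>0$ is the coherence interval. BS $l$ receives $Y^{[l]}_p(s)=\sum_{c}\sum_{k\in A(s)}\sqrt{P_p}\,g^{[l]}_{kc}(s)q_k(s)^\dagger+W^{[l]}_p(s)$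 ($P_p>0$), and the MMSE estimates are $$\hat g^{[l]}_{kc}(s)=\frac{\beta^{[l]}_{kc}}{\frac1{P_p}+\sum_{b=1}^C\beta^{[l]}_{kb}}\,\frac{Y^{[l]}_p(s)}{\sqrt{P_p}}\,q_k(s)\qquad(k\in A(s)),$$ with errors $\tilde g^{[l]}_{kc}=g^{[l]}_{kc}-\hat g^{[l]}_{kc}$. In slot $t$, $d_g\in\{0,\dots,t\}$ is the CSI delay of group $g$, i.e. $t-d_g$ is the last slot up to $t$ in which $g$ was trained (every group has been trained at least once). In slot $t$ BS $l$ receives the data signal $Y^{[l]}_u(t)=\sum_{c,k}\sqrt{P_u}\,g^{[l]}_{kc}(t)S_{kc}+W^{[l]}_u(t)$ ($P_u>0$). The entries of $W_p^{[l]}(s),W_u^{[l]}(t)$ are $\mathcal{CN}(0,1)$; all initial fading entries, innovation entries and noise entries are mutually independent, and independent of the family of symbols, which satisfies $\mathbb E[S_{kc}\overline{S_{k'c'}}]=1$ if $(k,c)=(k',c')$ and $0$ otherwise. BS $l$ detects user $(g,l)$ with the MRC receiver $u_{gl}=\hat g^{[l]}_{gl}(t-d_g)/\|\hat g^{[l]}_{gl}(t-d_g)\|$.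 Write $Y^{[l]}_u(t)/\sqrt{P_u}=I_1+I_2+I_3$ with $$I_1=(\rho^{[l]}_{gl})^{d_g}\hat g^{[l]}_{gl}(t-d_g)S_{gl},\qquad I_2=\sum_{c\ne l}(\rho^{[l]}_{gc})^{d_g}\hat g^{[l]}_{gc}(t-d_g)S_{gc},$$ $$I_3=\sum_{c}(\rho^{[l]}_{gc})^{d_g}\tilde g^{[l]}_{gc}(t-d_g)S_{gc}+\sum_c\sum_{j=0}^{d_g-1}(\rho^{[l]}_{gc})^j\sqrt{\beta^{[l]}_{gc}}\,\varepsilon^{[l]}_{gc}(t-j)S_{gc}+\sum_{k\ne g}\sum_c g^{[l]}_{kc}(t)S_{kc}+\frac{W^{[l]}_u(t)}{\sqrt{P_u}}.$$ The average uplink spectral efficiency is $$\bar R^{MRC}_u=\sum_{l=1}^C\sum_{g=1}^{N_G}\mathbb E\Big[\Big(1-\frac{\tau}{T_s}\Big)\log(1+\mathrm{SINR}_{gl})\Big]\in[0,\infty],$$ where $\mathrm{SINR}_{gl}$ is taken in either of two senses: (a) the power ratio $\mathbb E_{S,W}|u_{gl}^\dagger I_1|^2\big/\big(\mathbb E_{S,W}|u_{gl}^\dagger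 I_2|^2+\mathbb E_{S,W}|u_{gl}^\dagger I_3|^2\big)$, where $\mathbb E_{S,W}$ averages over the symbols and the data noise for fixed channels, estimates and receivers; or (b) the instantaneous ratio $|u_{gl}^\dagger I_1|^2/(|u_{gl}^\dagger I_2|^2+|u_{gl}^\dagger I_3|^2)$, for symbols of constant modulus ($|S_{kc}|=1$ almost surely). **Theorem 1.** In both senses (a) and (b), $$\bar R^{MRC}_u\ \ge\ \sum_{l=1}^{C}\sum_{g=1}^{N_G}\Big(1-\frac{\tau}{T_s}\Big)\log\Big(1+\frac{(M-1)(\beta^{[l]}_{gl})^2(\rho^{[l]}_{gl})^{2d_g}}{(M-1)I^p_{gl}+I^n_{gl}}\Big),$$ where $$I^p_{gl}=\sum_{c\ne l}(\rho^{[l]}_{gc})^{2d_g}(\beta^{[l]}_{gc})^2,$$ $$I^n_{gl}=\Big(\sum_{c=1}^{C}\sum_{k\ne g}\beta^{[l]}_{kc}+\sum_{c=1}^{C}\Big(\beta^{[l]}_{gc}-(\rho^{[l]}_{gc})^{2d_g}\frac{(\beta^{[l]}_{gc})^2}{\frac1{P_p}+\sum_{b=1}^{C}\beta^{[l]}_{gb}}\Big)+\frac1{P_u}\Big)\Big(\frac1{P_p}+\sum_{b=1}^{C}\beta^{[l]}_{gb}\Big).$$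 -/

import Mathlib

open MeasureTheory ProbabilityTheory
open scoped BigOperators ComplexConjugate ENNReal

noncomputable section

namespace CopilotUplink

/-- The circularly symmetric complex Gaussian law `CN(0, v)` on `ℂ`: independent real and
imaginary parts, each `N(0, v / 2)`. -/
def complexGaussian (v : ℝ) : Measure ℂ :=
  ((gaussianReal 0 (v / 2).toNNReal).prod (gaussianReal 0 (v / 2).toNNReal)).map
    Complex.measurableEquivRealProd.symm

/-- The deterministic data of the network: `C` cells (one base station, BS, per cell), `NG` copilot
groups with exactly one user per cell, `M` antennas per BS, pilot sequences of length `τ`.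
The user of group `k` in cell `c` is `(k, c)`; in `β l k c`, `ρ l k c` the first index is the
receiving BS. -/
structure Network (C NG M τ : ℕ) where
  /-- large-scale fading coefficients -/
  β : Fin C → Fin NG → Fin C → ℝ
  /-- temporal correlation coefficients -/
  ρ : Fin C → Fin NG → Fin C → ℝ
  /-- training power -/
  Pp : ℝ
  /-- uplink data power -/
  Pu : ℝ
  /-- coherence interval, in symbols -/
  Ts : ℝ
  /-- the groups that are trained in each slot -/
  trained : ℕ → Finset (Fin NG)
  /-- pilot sequence used by a group in a slot (only used if the group is trained there) -/
  q : ℕ → Fin NG → Fin τ → ℂ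
  β_pos : ∀ l k c, 0 < β l k c
  abs_ρ_le_one : ∀ l k c, |ρ l k c| ≤ 1
  Pp_pos : 0 < Pp
  Pu_pos : 0 < Pu
  Ts_pos : 0 < Ts
  τ_le_Ts : (τ : ℝ) ≤ Ts
  /-- the groups trained in the same slot use orthonormal pilot sequences of length `τ`, so at
  most `τ` groups are trained in a slot -/
  q_orthonormal : ∀ s, ∀ k ∈ trained s, ∀ k' ∈ trained s,
    ∑ j, conj (q s k j) * q s k' j = if k = k' then 1 else 0

/-- The scalar Gaussian sources of randomness: the entries of the fading vectors in slot `0`, of the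
innovations, of the pilot noise matrices, and of the data noise vectors. -/
inductive Source (C NG M τ : ℕ) : Type
  | fading (l : Fin C) (k : Fin NG) (c : Fin C) (i : Fin M)
  | innovation (l : Fin C) (k : Fin NG) (c : Fin C) (s : ℕ) (i : Fin M)
  | pilotNoise (l : Fin C) (s : ℕ) (i : Fin M) (j : Fin τ)
  | dataNoise (l : Fin C) (i : Fin M)

variable {C NG M τ : ℕ}

/-- The variances of the Gaussian sources. -/
def Network.sourceVariance (N : Network C NG M τ) : Source C NG M τ → ℝ
  | .fading _ _ _ _ => 1
  | .innovation l k c _ _ => 1 - N.ρ l k c ^ 2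
  | .pilotNoise _ _ _ _ => 1
  | .dataNoise _ _ => 1

/-- The random model of the uplink, on a probability space: the independent complex Gaussian
sources, and the data symbols `S k c` that the users send in the slot under study.
The symbols are independent of the sources, have unit energy, and symbols of
distinct users are uncorrelated. -/
structure Model (N : Network C NG M τ) {Ω : Type*} [MeasurableSpace Ω] (μ : Measure Ω) where
  Z : Source C NG M τ → Ω → ℂ
  S : Fin NG → Fin C → Ω → ℂ
  measurable_Z : ∀ x, Measurable (Z x)
  measurable_S : ∀ k c, Measurable (S k c)
  law_Z : ∀ x, μ.map (Z x) = complexGaussian (N.sourceVariance x)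
  indep_Z : iIndepFun Z μ
  indep_S_Z : IndepFun (fun ω (kc : Fin NG × Fin C) => S kc.1 kc.2 ω) (fun ω x => Z x ω) μ
  symbol_corr : ∀ k c k' c',
    ∫ ω, S k c ω * conj (S k' c' ω) ∂μ = if k = k' ∧ c = c' then 1 else 0

namespace Model

variable {N : Network C NG M τ} {Ω : Type*} [MeasurableSpace Ω] {μ : Measure Ω}

/-- Innovation `ε` of the channel from user `(k, c)` to BS `l` in slot `s`,
with law `CN(0, (1 - ρ²) I)`. -/
def ε (X : Model N μ) (l : Fin C) (k : Fin NG) (c : Fin C) (s : ℕ) (ω : Ω) :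
    EuclideanSpace ℂ (Fin M) :=
  WithLp.toLp 2 fun i => X.Z (.innovation l k c s i) ω

/-- Fast fading vector: `h(0) ~ CN(0, I)` and `h(s + 1) = ρ h(s) + ε(s + 1)`. -/
def h (X : Model N μ) (l : Fin C) (k : Fin NG) (c : Fin C) : ℕ → Ω → EuclideanSpace ℂ (Fin M)
  | 0, ω => WithLp.toLp 2 fun i => X.Z (.fading l k c i) ω
  | s + 1, ω => (N.ρ l k c : ℂ) • X.h l k c s ω + X.ε l k c (s + 1) ω

/-- Channel vector from user `(k, c)` to BS `l` in slot `s`. -/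
def g (X : Model N μ) (l : Fin C) (k : Fin NG) (c : Fin C) (s : ℕ) (ω : Ω) :
    EuclideanSpace ℂ (Fin M) :=
  (√(N.β l k c) : ℂ) • X.h l k c s ω

/-- Pilot signal received by BS `l` in slot `s`. -/
def Yp (X : Model N μ) (l : Fin C) (s : ℕ) (ω : Ω) : Matrix (Fin M) (Fin τ) ℂ :=
  Matrix.of fun i j =>
    (∑ c, ∑ k ∈ N.trained s, (√N.Pp : ℂ) * X.g l k c s ω i * conj (N.q s k j))
      + X.Z (.pilotNoise l s i j) ω

/-- MMSE estimate, at BS `l`, of the channel from user `(k, c)` in a slot `s` in which group `k`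
is trained. -/
def gHat (X : Model N μ) (l : Fin C) (k : Fin NG) (c : Fin C) (s : ℕ) (ω : Ω) :
    EuclideanSpace ℂ (Fin M) :=
  ((N.β l k c / (1 / N.Pp + ∑ b, N.β l k b) : ℝ) : ℂ) •
    ((√N.Pp : ℂ)⁻¹ • WithLp.toLp 2 ((X.Yp l s ω).mulVec (N.q s k)))

/-- Channel estimation error. -/
def gTilde (X : Model N μ) (l : Fin C) (k : Fin NG) (c : Fin C) (s : ℕ) (ω : Ω) :
    EuclideanSpace ℂ (Fin M) :=
  X.g l k c s ω - X.gHat l k c s ω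

/-- Data noise at BS `l`. -/
def Wu (X : Model N μ) (l : Fin C) (ω : Ω) : EuclideanSpace ℂ (Fin M) :=
  WithLp.toLp 2 fun i => X.Z (.dataNoise l i) ω

/-- All the symbols of the slot, as a vector. -/
def symbols (X : Model N μ) (ω : Ω) : Fin NG → Fin C → ℂ := fun k c => X.S k c ω

/-- Data signal received by BS `l` in slot `t`, for channels at `ω`, symbols `σ`, noise `w`. -/
def Yu (X : Model N μ) (t : ℕ) (l : Fin C) (ω : Ω) (σ : Fin NG → Fin C → ℂ)
    (w : EuclideanSpace ℂ (Fin M)) : EuclideanSpace ℂ (Fin M) :=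
  (∑ c, ∑ k, ((√N.Pu : ℂ) * σ k c) • X.g l k c t ω) + w

/-- MRC receiver of user `(k, l)` at BS `l` in slot `t`, for CSI delays `d`. -/
def u (X : Model N μ) (t : ℕ) (d : Fin NG → ℕ) (l : Fin C) (k : Fin NG) (ω : Ω) :
    EuclideanSpace ℂ (Fin M) :=
  (‖X.gHat l k l (t - d k) ω‖ : ℂ)⁻¹ • X.gHat l k l (t - d k) ω

/-- Useful signal of user `(k, l)`. -/
def I₁ (X : Model N μ) (t : ℕ) (d : Fin NG → ℕ) (l : Fin C) (k : Fin NG) (ω : Ω)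
    (σ : Fin NG → Fin C → ℂ) : EuclideanSpace ℂ (Fin M) :=
  ((N.ρ l k l : ℂ) ^ d k * σ k l) • X.gHat l k l (t - d k) ω

/-- Pilot contamination. -/
def I₂ (X : Model N μ) (t : ℕ) (d : Fin NG → ℕ) (l : Fin C) (k : Fin NG) (ω : Ω)
    (σ : Fin NG → Fin C → ℂ) : EuclideanSpace ℂ (Fin M) :=
  ∑ c ∈ Finset.univ.erase l, ((N.ρ l k c : ℂ) ^ d k * σ k c) • X.gHat l k c (t - d k) ω

/-- Estimation error, aging, interference of the other groups, and noise. -/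
def I₃ (X : Model N μ) (t : ℕ) (d : Fin NG → ℕ) (l : Fin C) (k : Fin NG) (ω : Ω)
    (σ : Fin NG → Fin C → ℂ) (w : EuclideanSpace ℂ (Fin M)) : EuclideanSpace ℂ (Fin M) :=
  (∑ c, ((N.ρ l k c : ℂ) ^ d k * σ k c) • X.gTilde l k c (t - d k) ω)
    + (∑ c, ∑ j ∈ Finset.range (d k),
        ((N.ρ l k c : ℂ) ^ j * (√(N.β l k c) : ℂ) * σ k c) • X.ε l k c (t - j) ω)
    + (∑ k' ∈ Finset.univ.erase k, ∑ c, σ k' c • X.g l k' c t ω)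
    + (√N.Pu : ℂ)⁻¹ • w

theorem g_unroll (X : Model N μ) (l : Fin C) (k : Fin NG) (c : Fin C) (ω : Ω) (t n : ℕ)
    (hn : n ≤ t) :
    X.g l k c t ω = (N.ρ l k c : ℂ) ^ n • X.g l k c (t - n) ω
      + ∑ j ∈ Finset.range n,
          ((N.ρ l k c : ℂ) ^ j * (√(N.β l k c) : ℂ)) • X.ε l k c (t - j) ω := by
  induction n with
  | zero => simp
  | succ n ih =>
    rw [ih (by omega), Finset.sum_range_succ]
    obtain ⟨m, hm⟩ : ∃ m, t - n = m + 1 := ⟨t - n - 1, by omega⟩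
    have hm' : t - (n + 1) = m := by omega
    rw [hm', hm]
    simp only [g, h, smul_add, smul_smul]
    rw [add_assoc, add_comm (∑ j ∈ Finset.range n, _)]
    congr 2
    ring

/-- `I₁ + I₂ + I₃` is the received data signal, divided by `√Pu`. -/
theorem received_decomposition (X : Model N μ) (t : ℕ) (d : Fin NG → ℕ) (l : Fin C) (k : Fin NG)
    (hd : d k ≤ t) (ω : Ω) (σ : Fin NG → Fin C → ℂ) (w : EuclideanSpace ℂ (Fin M)) :
    (√N.Pu : ℂ)⁻¹ • X.Yu t l ω σ w
      = X.I₁ t d l k ω σ + X.I₂ t d l k ω σ + X.I₃ t d l k ω σ w := by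
  have hP : (√N.Pu : ℂ) ≠ 0 := by
    exact_mod_cast (Real.sqrt_pos.2 N.Pu_pos).ne'
  have h1 : (√N.Pu : ℂ)⁻¹ • X.Yu t l ω σ w
      = (∑ k', ∑ c, σ k' c • X.g l k' c t ω) + (√N.Pu : ℂ)⁻¹ • w := by
    rw [Yu, smul_add, Finset.sum_comm]
    simp only [Finset.smul_sum, smul_smul]
    congr 1
    refine Finset.sum_congr rfl fun k' _ => Finset.sum_congr rfl fun c _ => ?_
    rw [← mul_assoc, inv_mul_cancel₀ hP, one_mul]
  have h2 : X.I₁ t d l k ω σ + X.I₂ t d l k ω σ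
      = ∑ c, ((N.ρ l k c : ℂ) ^ d k * σ k c) • X.gHat l k c (t - d k) ω := by
    rw [I₁, I₂, Finset.add_sum_erase _ (fun c => ((N.ρ l k c : ℂ) ^ d k * σ k c) •
      X.gHat l k c (t - d k) ω) (Finset.mem_univ l)]
  have h3 : ∑ c, σ k c • X.g l k c t ω
      = (∑ c, ((N.ρ l k c : ℂ) ^ d k * σ k c) • X.gHat l k c (t - d k) ω)
        + (∑ c, ((N.ρ l k c : ℂ) ^ d k * σ k c) • X.gTilde l k c (t - d k) ω)
        + ∑ c, ∑ j ∈ Finset.range (d k),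
            ((N.ρ l k c : ℂ) ^ j * (√(N.β l k c) : ℂ) * σ k c) • X.ε l k c (t - j) ω := by
    rw [← Finset.sum_add_distrib, ← Finset.sum_add_distrib]
    refine Finset.sum_congr rfl fun c _ => ?_
    rw [gTilde, ← smul_add, add_sub_cancel, X.g_unroll l k c ω t (d k) hd, smul_add,
      Finset.smul_sum, smul_smul, mul_comm (σ k c)]
    congr 1
    refine Finset.sum_congr rfl fun j _ => ?_
    rw [smul_smul, mul_comm (σ k c)]
  rw [h1, h2, I₃, ← Finset.add_sum_erase _ _ (Finset.mem_univ k), h3]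
  abel

/-- Instantaneous SINR of user `(k, l)`, with the actual symbols and the actual data noise. -/
def sinr (X : Model N μ) (t : ℕ) (d : Fin NG → ℕ) (l : Fin C) (k : Fin NG) (ω : Ω) : ℝ :=
  ‖inner ℂ (X.u t d l k ω) (X.I₁ t d l k ω (X.symbols ω))‖ ^ 2 /
    (‖inner ℂ (X.u t d l k ω) (X.I₂ t d l k ω (X.symbols ω))‖ ^ 2
      + ‖inner ℂ (X.u t d l k ω) (X.I₃ t d l k ω (X.symbols ω) (X.Wu l ω))‖ ^ 2)

/-- SINR of user `(k, l)` as a ratio of powers: the channels, the channel estimates and the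
receiver are frozen at `ω`, and the symbols and the data noise (which are independent of them)
are averaged out. -/
def sinrPower (X : Model N μ) (t : ℕ) (d : Fin NG → ℕ) (l : Fin C) (k : Fin NG) (ω : Ω) : ℝ :=
  (∫ ω', ‖inner ℂ (X.u t d l k ω) (X.I₁ t d l k ω (X.symbols ω'))‖ ^ 2 ∂μ) /
    ((∫ ω', ‖inner ℂ (X.u t d l k ω) (X.I₂ t d l k ω (X.symbols ω'))‖ ^ 2 ∂μ)
      + ∫ ω', ‖inner ℂ (X.u t d l k ω)
          (X.I₃ t d l k ω (X.symbols ω') (X.Wu l ω'))‖ ^ 2 ∂μ)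

/-- Average achievable uplink spectral efficiency of the network in slot `t`, for a given SINR of
each user. The rates are nonnegative; their expectations are taken in `[0, ∞]`. -/
def averageSE (_X : Model N μ) (γ : Fin C → Fin NG → Ω → ℝ) : ℝ≥0∞ :=
  ∑ l, ∑ k, ∫⁻ ω, ENNReal.ofReal ((1 - τ / N.Ts) * Real.log (1 + γ l k ω)) ∂μ

end Model

namespace Network

/-- `d k` is the CSI delay of group `k` in slot `t`: the last slot up to `t` in which the group was
trained is `t - d k`. -/
def IsCSIDelay (N : Network C NG M τ) (t : ℕ) (d : Fin NG → ℕ) : Prop :=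
  ∀ k, d k ≤ t ∧ k ∈ N.trained (t - d k) ∧ ∀ s, t - d k < s → s ≤ t → k ∉ N.trained s

/-- Pilot contamination term of the bound. -/
def Ip (N : Network C NG M τ) (d : Fin NG → ℕ) (l : Fin C) (k : Fin NG) : ℝ :=
  ∑ c ∈ Finset.univ.erase l, N.ρ l k c ^ (2 * d k) * N.β l k c ^ 2

/-- Noise, interference, estimation-error and aging term of the bound. -/
def In (N : Network C NG M τ) (d : Fin NG → ℕ) (l : Fin C) (k : Fin NG) : ℝ :=
  ((∑ c, ∑ k' ∈ Finset.univ.erase k, N.β l k' c)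
    + (∑ c, (N.β l k c
        - N.ρ l k c ^ (2 * d k) * (N.β l k c ^ 2 / (1 / N.Pp + ∑ b, N.β l k b))))
    + 1 / N.Pu) * (1 / N.Pp + ∑ b, N.β l k b)

/-- The lower bound on the average spectral efficiency. -/
def seBound (N : Network C NG M τ) (d : Fin NG → ℕ) : ℝ :=
  ∑ l, ∑ k, (1 - τ / N.Ts) * Real.log (1 +
    (((M : ℝ) - 1) * N.β l k l ^ 2 * N.ρ l k l ^ (2 * d k)) /
      (((M : ℝ) - 1) * N.Ip d l k + N.In d l k))

end Network

end CopilotUplink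

end

noncomputable section

namespace CopilotUplink

/-! ### Jensen's inequality, independence and second moments. -/

section
variable {Ω : Type*} [MeasurableSpace Ω] {μ : Measure Ω}

/-! Fix a BS `l` and a group `k`, and let `y` be the scaled correlator output `Yp q / √Pp` of the
last training slot. Pilot contamination means that the estimates of all users of the group are real
multiples `β / D` of this one vector, whose entries are independent `CN(0, D)` with `D = 1/Pp + ∑ β`
(`gHat_eq`, `covar_yCoef`). Hence the MRC receiver is `y / ‖y‖`, and useful signal and contamination
both point along `y`, with powers `a ‖y‖² / D²` and `B ‖y‖² / D²`. Here `a = β² ρ^(2d)`, and `B` is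
the contamination energy, with mean `Ip`.

The rest of the received signal is `∑ S v + W / √Pu` (`I₃_eq`). For the user's own group, `v` is the
present channel minus its linear regression on `y`, because estimation error and aging combine to
exactly this; for other groups it is the whole channel. Each `v` is uncorrelated with `y`, and all
variables are linear in the Gaussian sources, so `y` is independent of the `v` and of the noise
(`indepFun_y`). For a frozen unit receiver the interference power `Q` therefore has mean `K`, the
sum of the variances of `v` plus `1/Pu`, and `In = K D` (`In_eq`).

Dividing by `‖y‖²`, `1 / SINR = (B + D² Q / ‖y‖²) / a`. The function `log (1 + 1/x)` is convex and
decreasing, so Jensen's inequality needs only an upper bound on the mean of this ratio. By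
independence that reduces to `E[1/‖y‖²] ≤ 1 / (D (M - 1))` for `M ≥ 2`, obtained from the Laplace
transform (`lintegral_one_div_sum_norm_sq_le`). The result is `(Ip + D K / (M - 1)) / a`, the
reciprocal of the ratio in the bound. If `M = 1` or `a = 0`, the bound for that user is zero.

The two senses of SINR differ only in `B` and `Q`: averaged over symbols and data noise in one,
instantaneous in the other. Constant modulus makes the instantaneous numerator equal to its average.
-/

/-- The tangent at `m` of the convex function `log (1 + 1/x)`, with its terms moved so that both
sides are sums of nonnegative numbers and can be integrated in `[0, ∞]`. After `log z ≤ z - 1`, the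
remaining gap is a square over a positive number. -/
theorem log_one_add_inv_tangent {m x : ℝ} (hm : 0 < m) (hx : 0 < x) :
    Real.log (1 + 1 / m) + 1 / (m + 1) ≤ Real.log (1 + 1 / x) + 1 / (m * (m + 1)) * x := by
  have h1 : 1 + 1 / m = (1 + 1 / x) * (((m + 1) * x) / (m * (x + 1))) := by
    field_simp
  have h2 := Real.log_le_sub_one_of_pos (x := ((m + 1) * x) / (m * (x + 1))) (by positivity)
  have h3 : 1 / (m * (m + 1)) * x - 1 / (m + 1) - (((m + 1) * x) / (m * (x + 1)) - 1)
      = (x - m) ^ 2 / (m * (m + 1) * (x + 1)) := by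
    field_simp
    ring
  have h4 : 0 ≤ (x - m) ^ 2 / (m * (m + 1) * (x + 1)) := by positivity
  rw [h1, Real.log_mul (by positivity) (by positivity)]
  linarith

/-- Jensen's inequality for `x ↦ log (1 + 1 / x)`. -/
theorem ofReal_log_le_lintegral [IsProbabilityMeasure μ] {R : Ω → ℝ} {m : ℝ} (hm : 0 < m)
    (hRm : AEMeasurable R μ) (hR : ∀ᵐ ω ∂μ, 0 < R ω)
    (hint : ∫⁻ ω, ENNReal.ofReal (R ω) ∂μ ≤ ENNReal.ofReal m) :
    ENNReal.ofReal (Real.log (1 + 1 / m))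
      ≤ ∫⁻ ω, ENNReal.ofReal (Real.log (1 + 1 / R ω)) ∂μ := by
  have hlog : ∀ x : ℝ, 0 < x → 0 ≤ Real.log (1 + 1 / x) := fun x hx =>
    Real.log_nonneg (by have : 0 < 1 / x := by positivity
                        linarith)
  have hm1 : (0 : ℝ) ≤ 1 / (m * (m + 1)) := by positivity
  have key : ENNReal.ofReal (Real.log (1 + 1 / m)) + ENNReal.ofReal (1 / (m + 1))
      ≤ (∫⁻ ω, ENNReal.ofReal (Real.log (1 + 1 / R ω)) ∂μ) + ENNReal.ofReal (1 / (m + 1)) := by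
    calc ENNReal.ofReal (Real.log (1 + 1 / m)) + ENNReal.ofReal (1 / (m + 1))
        = ∫⁻ _, ENNReal.ofReal (Real.log (1 + 1 / m) + 1 / (m + 1)) ∂μ := by
          rw [lintegral_const, measure_univ, mul_one,
            ENNReal.ofReal_add (hlog m hm) (by positivity)]
      _ ≤ ∫⁻ ω, (ENNReal.ofReal (Real.log (1 + 1 / R ω))
            + ENNReal.ofReal (1 / (m * (m + 1))) * ENNReal.ofReal (R ω)) ∂μ := by
          refine lintegral_mono_ae ?_
          filter_upwards [hR] with ω hω
          rw [← ENNReal.ofReal_mul hm1, ← ENNReal.ofReal_add (hlog _ hω) (by positivity)]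
          exact ENNReal.ofReal_le_ofReal (log_one_add_inv_tangent hm hω)
      _ = (∫⁻ ω, ENNReal.ofReal (Real.log (1 + 1 / R ω)) ∂μ)
            + ENNReal.ofReal (1 / (m * (m + 1))) * ∫⁻ ω, ENNReal.ofReal (R ω) ∂μ := by
          rw [lintegral_add_right' _ (by fun_prop), lintegral_const_mul'' _ (by fun_prop)]
      _ ≤ _ := by
          gcongr
          refine (mul_le_mul_right hint _).trans ?_
          rw [← ENNReal.ofReal_mul hm1]
          apply ENNReal.ofReal_le_ofReal
          apply le_of_eq
          field_simp
  -- The finite constant `1 / (m + 1)` cancels even if the expected logarithm is infinite, so no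
  -- integrability is needed.
  exact (ENNReal.add_le_add_iff_right ENNReal.ofReal_ne_top).1 key

/-- Tonelli for the joint law: `Y` can be frozen while `V` is averaged, which replaces conditioning
on `Y`. -/
theorem lintegral_of_indepFun [IsProbabilityMeasure μ] {E F : Type*} [MeasurableSpace E]
    [MeasurableSpace F] {Y : Ω → E} {V : Ω → F} (hY : Measurable Y) (hV : Measurable V)
    (h : IndepFun Y V μ) {f : E → F → ℝ≥0∞} (hf : Measurable (Function.uncurry f)) :
    ∫⁻ ω, f (Y ω) (V ω) ∂μ = ∫⁻ ω, ∫⁻ ω', f (Y ω) (V ω') ∂μ ∂μ := by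
  have h1 := (indepFun_iff_map_prod_eq_prod_map_map hY.aemeasurable hV.aemeasurable).1 h
  have h2 : ∫⁻ ω, f (Y ω) (V ω) ∂μ
      = ∫⁻ p, Function.uncurry f p ∂(μ.map fun ω => (Y ω, V ω)) := by
    rw [lintegral_map hf (hY.prodMk hV)]; rfl
  have : IsProbabilityMeasure (μ.map V) := Measure.isProbabilityMeasure_map hV.aemeasurable
  rw [h2, h1, lintegral_prod _ hf.aemeasurable, lintegral_map (by fun_prop) hY]
  refine lintegral_congr fun ω => ?_
  rw [lintegral_map (by fun_prop) hV]; rfl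

/-- If `S` is independent of `(Y, V)` and `Y` of `V`, then `Y` is independent of `(S, V)`. -/
theorem indepFun_prodMk_of_indepFun [IsProbabilityMeasure μ] {D E F : Type*} [MeasurableSpace D]
    [MeasurableSpace E] [MeasurableSpace F] {S : Ω → D} {Y : Ω → E} {V : Ω → F}
    (hS : Measurable S) (hY : Measurable Y) (hV : Measurable V)
    (h1 : IndepFun S (fun ω => (Y ω, V ω)) μ) (h2 : IndepFun Y V μ) :
    IndepFun Y (fun ω => (S ω, V ω)) μ := by
  rw [indepFun_iff_map_prod_eq_prod_map_map hY.aemeasurable (by fun_prop)]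
  have := Measure.isProbabilityMeasure_map (μ := μ) hY.aemeasurable
  have : IsProbabilityMeasure (μ.map fun ω => (S ω, V ω)) :=
    Measure.isProbabilityMeasure_map (by fun_prop)
  have : IsProbabilityMeasure (μ.map fun ω => (Y ω, S ω, V ω)) :=
    Measure.isProbabilityMeasure_map (by fun_prop)
  have h3 : IndepFun S V μ := h1.comp measurable_id measurable_snd
  refine Measure.ext_prod₃ fun {s t u} hs ht hu => ?_
  rw [Measure.prod_prod, Measure.map_apply (by fun_prop) (hs.prod (ht.prod hu)),
    Measure.map_apply hY hs, Measure.map_apply (by fun_prop) (ht.prod hu)]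
  have e1 : (fun ω => (Y ω, S ω, V ω)) ⁻¹' s ×ˢ t ×ˢ u
      = S ⁻¹' t ∩ (fun ω => (Y ω, V ω)) ⁻¹' (s ×ˢ u) := by
    ext ω; simp; tauto
  have e2 : (fun ω => (Y ω, V ω)) ⁻¹' (s ×ˢ u) = Y ⁻¹' s ∩ V ⁻¹' u := by ext ω; simp
  have e3 : (fun ω => (S ω, V ω)) ⁻¹' (t ×ˢ u) = S ⁻¹' t ∩ V ⁻¹' u := by ext ω; simp
  rw [e1, h1.measure_inter_preimage_eq_mul _ _ ht (hs.prod hu), e2, e3,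
    h2.measure_inter_preimage_eq_mul _ _ hs hu, h3.measure_inter_preimage_eq_mul _ _ ht hu]
  ring

theorem MemLp.integrable_mul_conj {f g : Ω → ℂ} (hf : MemLp f 2 μ) (hg : MemLp g 2 μ) :
    Integrable (fun ω => f ω * conj (g ω)) μ :=
  hf.integrable_mul hg.star

theorem MemLp.integrable_norm_sq {f : Ω → ℂ} (hf : MemLp f 2 μ) :
    Integrable (fun ω => ‖f ω‖ ^ 2) μ := hf.integrable_norm_pow two_ne_zero

theorem ofReal_integral_norm_sq (f : Ω → ℂ) :
    ((∫ ω, ‖f ω‖ ^ 2 ∂μ : ℝ) : ℂ) = ∫ ω, f ω * conj (f ω) ∂μ := by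
  rw [← integral_complex_ofReal]
  congr with ω
  rw [Complex.mul_conj, Complex.normSq_eq_norm_sq]

theorem integral_norm_sq_sum_of_orthogonal {ι : Type*} [Fintype ι] {T : ι → Ω → ℂ}
    (hT : ∀ i, MemLp (T i) 2 μ) (h : ∀ i j, i ≠ j → ∫ ω, T i ω * conj (T j ω) ∂μ = 0) :
    ∫ ω, ‖∑ i, T i ω‖ ^ 2 ∂μ = ∑ i, ∫ ω, ‖T i ω‖ ^ 2 ∂μ := by
  rw [← Complex.ofReal_inj, ofReal_integral_norm_sq, Complex.ofReal_sum]
  simp_rw [ofReal_integral_norm_sq, map_sum, Finset.sum_mul_sum]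
  rw [integral_finsetSum _ fun i _ => integrable_finsetSum _ fun j _ =>
    MemLp.integrable_mul_conj (hT i) (hT j)]
  refine Finset.sum_congr rfl fun i _ => ?_
  rw [integral_finsetSum _ fun j _ => MemLp.integrable_mul_conj (hT i) (hT j)]
  exact Finset.sum_eq_single i (fun j _ hj => h i j hj.symm) (by simp)

theorem memLp_two_mul_of_indepFun [IsProbabilityMeasure μ] {f g : Ω → ℂ} (hf : MemLp f 2 μ)
    (hg : MemLp g 2 μ) (h : IndepFun f g μ) : MemLp (fun ω => f ω * g ω) 2 μ := by
  have hm : AEStronglyMeasurable (fun ω => f ω * g ω) μ := hf.1.mul hg.1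
  rw [memLp_two_iff_integrable_sq_norm hm]
  have h' : IndepFun (fun ω => ‖f ω‖ ^ 2) (fun ω => ‖g ω‖ ^ 2) μ :=
    h.comp (φ := fun z : ℂ => ‖z‖ ^ 2) (ψ := fun z : ℂ => ‖z‖ ^ 2) (by fun_prop) (by fun_prop)
  simpa [mul_pow, Pi.mul_def] using
    h'.integrable_mul (MemLp.integrable_norm_sq hf) (MemLp.integrable_norm_sq hg)

/-- Second moment of a combination of orthonormal symbols whose coefficients are independent
of them. -/
theorem memLp_and_integral_norm_sq_sum_mul_add [IsProbabilityMeasure μ] {κ : Type*} [Fintype κ]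
    [DecidableEq κ] {S v : κ → Ω → ℂ} {w : Ω → ℂ} (hS : ∀ k, MemLp (S k) 2 μ)
    (hv : ∀ k, MemLp (v k) 2 μ) (hw : MemLp w 2 μ)
    (hind : IndepFun (fun ω k => S k ω) (fun ω => ((fun k => v k ω), w ω)) μ)
    (hSS : ∀ k k', ∫ ω, S k ω * conj (S k' ω) ∂μ = if k = k' then 1 else 0)
    (hvw : ∀ k, ∫ ω, v k ω * conj (w ω) ∂μ = 0) :
    MemLp (fun ω => ∑ k, S k ω * v k ω + w ω) 2 μ ∧
    ∫ ω, ‖∑ k, S k ω * v k ω + w ω‖ ^ 2 ∂μ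
      = ∑ k, ∫ ω, ‖v k ω‖ ^ 2 ∂μ + ∫ ω, ‖w ω‖ ^ 2 ∂μ := by
  have hSv : ∀ k, MemLp (fun ω => S k ω * v k ω) 2 μ := fun k =>
    memLp_two_mul_of_indepFun (hS k) (hv k)
      (hind.comp (φ := fun s : κ → ℂ => s k) (ψ := fun p : (κ → ℂ) × ℂ => p.1 k)
        (by fun_prop) (by fun_prop))
  refine ⟨(memLp_finsetSum _ fun k _ => hSv k).add hw, ?_⟩
  -- The extra index `none` carries `w`, so that Pythagoras treats noise and symbol terms together.
  let T : Option κ → Ω → ℂ := fun o ω => o.elim (w ω) fun k => S k ω * v k ω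
  have hT : ∀ o, MemLp (T o) 2 μ := by
    rintro (_ | k)
    exacts [hw, hSv k]
  -- The symbol correlation factors out and vanishes off the diagonal; the coefficients `v` may be
  -- correlated with each other.
  have hprod : ∀ k k', ∫ ω, (S k ω * v k ω) * conj (S k' ω * v k' ω) ∂μ
      = (∫ ω, S k ω * conj (S k' ω) ∂μ) * ∫ ω, v k ω * conj (v k' ω) ∂μ := by
    intro k k'
    have := (hind.comp (φ := fun s : κ → ℂ => s k * conj (s k'))
      (ψ := fun p : (κ → ℂ) × ℂ => p.1 k * conj (p.1 k'))
      (by fun_prop) (by fun_prop)).integral_fun_mul_eq_mul_integral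
        (((hS k).1.mul (hS k').star.1)) ((hv k).1.mul (hv k').star.1)
    simp only [Function.comp_def] at this
    rw [← this]
    congr with ω
    simp only [map_mul]
    ring
  have hcross : ∀ k, ∫ ω, (S k ω * v k ω) * conj (w ω) ∂μ = 0 := by
    intro k
    have := (hind.comp (φ := fun s : κ → ℂ => s k)
      (ψ := fun p : (κ → ℂ) × ℂ => p.1 k * conj p.2)
      (by fun_prop) (by fun_prop)).integral_fun_mul_eq_mul_integral
        (hS k).1 ((hv k).1.mul hw.star.1)
    simp only [Function.comp_def, hvw, mul_zero] at this
    rw [← this]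
    congr with ω
    ring
  have hcross' : ∀ k, ∫ ω, w ω * conj (S k ω * v k ω) ∂μ = 0 := by
    intro k
    have := congrArg conj (hcross k)
    rw [← integral_conj, map_zero] at this
    rw [← this]
    congr with ω
    simp [mul_comm]
  have horth : ∀ i j, i ≠ j → ∫ ω, T i ω * conj (T j ω) ∂μ = 0 := by
    rintro (_ | k) (_ | k') hne
    · exact absurd rfl hne
    · exact hcross' k'
    · exact hcross k
    · have : k ≠ k' := fun h => hne (by rw [h])
      exact (hprod k k').trans (by rw [hSS, if_neg this, zero_mul])
  have := integral_norm_sq_sum_of_orthogonal hT horth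
  simp only [Fintype.sum_option, T, Option.elim] at this
  simp_rw [add_comm (∑ k, S k _ * v k _)]
  rw [this, add_comm]
  congr 1
  refine Finset.sum_congr rfl fun k _ => ?_
  rw [← Complex.ofReal_inj, ofReal_integral_norm_sq, hprod, hSS, if_pos rfl, one_mul,
    ofReal_integral_norm_sq]

theorem ae_mem_of_indepFun [IsProbabilityMeasure μ] {E F : Type*} [MeasurableSpace E]
    [MeasurableSpace F] {Y : Ω → E} {V : Ω → F} (hY : Measurable Y) (hV : Measurable V)
    (h : IndepFun Y V μ) {s : Set (E × F)} (hs : MeasurableSet s)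
    (hsV : ∀ x, ∀ᵐ ω ∂μ, (x, V ω) ∈ s) : ∀ᵐ ω ∂μ, (Y ω, V ω) ∈ s := by
  have h1 := (indepFun_iff_map_prod_eq_prod_map_map hY.aemeasurable hV.aemeasurable).1 h
  have : IsProbabilityMeasure (μ.map V) := Measure.isProbabilityMeasure_map hV.aemeasurable
  have h2 : ∀ᵐ p ∂(μ.map fun ω => (Y ω, V ω)), p ∈ s := by
    rw [h1, Measure.ae_prod_mem_iff_ae_ae_mem hs]
    refine .of_forall fun x => ?_
    exact (ae_map_iff hV.aemeasurable (measurable_prodMk_left hs)).2 (hsV x)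
  exact (ae_map_iff (hY.prodMk hV).aemeasurable hs).1 h2

/-- A sum of independent variables, one of which has no atoms, is almost surely nonzero. -/
theorem ae_add_ne_zero_of_indepFun [IsProbabilityMeasure μ] {A B : Ω → ℂ} (hA : Measurable A)
    (hB : Measurable B) (h : IndepFun A B μ) (hat : ∀ z, μ (A ⁻¹' {z}) = 0) :
    ∀ᵐ ω ∂μ, A ω + B ω ≠ 0 := by
  have hs : MeasurableSet {p : ℂ × ℂ | p.2 + p.1 ≠ 0} :=
    (measurableSet_eq_fun (by fun_prop) (by fun_prop)).compl
  refine ae_mem_of_indepFun hB hA h.symm hs fun x => ?_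
  rw [ae_iff]
  refine measure_mono_null (fun ω hω => ?_) (hat (-x))
  exact eq_neg_of_add_eq_zero_left (not_not.1 hω)

end

/-! ### The complex Gaussian law. -/

section
theorem integrable_gaussianReal_sq (v : NNReal) : Integrable (fun x => x ^ 2) (gaussianReal 0 v) :=
  (memLp_id_gaussianReal (μ := 0) (v := v) 2).integrable_sq

theorem integral_gaussianReal_sq (v : NNReal) : ∫ x, x ^ 2 ∂gaussianReal 0 v = v := by
  have h := variance_fun_id_gaussianReal (μ := 0) (v := v)
  rw [variance_eq_integral (by fun_prop)] at h
  simpa using h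

instance (v : ℝ) : IsGaussian (complexGaussian v) := by
  have : complexGaussian v = ((gaussianReal 0 (v / 2).toNNReal).prod
      (gaussianReal 0 (v / 2).toNNReal)).map Complex.equivRealProdCLM.symm := rfl
  rw [this]
  infer_instance

theorem integral_complexGaussian {v : ℝ} (f : ℂ → ℂ) :
    ∫ z, f z ∂complexGaussian v = ∫ p : ℝ × ℝ, f (p.1 + p.2 * Complex.I)
      ∂(gaussianReal 0 (v / 2).toNNReal).prod (gaussianReal 0 (v / 2).toNNReal) := by
  rw [complexGaussian, integral_map_equiv]
  refine integral_congr_ae (.of_forall fun p => ?_)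
  exact congrArg f (Complex.mk_eq_add_mul_I p.1 p.2)

theorem integral_id_complexGaussian (v : ℝ) : ∫ z, z ∂complexGaussian v = 0 := by
  rw [integral_complexGaussian (fun z => z)]
  have h : Integrable (fun x : ℝ => x) (gaussianReal 0 (v / 2).toNNReal) :=
    (memLp_id_gaussianReal (μ := 0) (v := (v / 2).toNNReal) 1).integrable (by simp)
  rw [integral_add (h.comp_fst _).ofReal ((h.comp_snd _).ofReal.mul_const _), integral_mul_const,
    integral_complex_ofReal, integral_complex_ofReal]
  have h1 := integral_fun_fst (μ := gaussianReal 0 (v / 2).toNNReal)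
    (ν := gaussianReal 0 (v / 2).toNNReal) (fun x : ℝ => x)
  have h2 := integral_fun_snd (μ := gaussianReal 0 (v / 2).toNNReal)
    (ν := gaussianReal 0 (v / 2).toNNReal) (fun x : ℝ => x)
  rw [h1, h2]
  simp [integral_id_gaussianReal]

/-- Circular symmetry: the squares of the real and imaginary parts have equal means. It makes the
Hermitian covariance alone determine all real second moments. -/
theorem integral_mul_self_complexGaussian (v : ℝ) : ∫ z, z * z ∂complexGaussian v = 0 := by
  rw [integral_complexGaussian (fun z => z * z)]
  have hm : Integrable (fun x : ℝ => x) (gaussianReal 0 (v / 2).toNNReal) :=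
    (memLp_id_gaussianReal (μ := 0) (v := (v / 2).toNNReal) 1).integrable (by simp)
  have h := integrable_gaussianReal_sq (v / 2).toNNReal
  have e : ∀ p : ℝ × ℝ, ((p.1 : ℂ) + p.2 * Complex.I) * (p.1 + p.2 * Complex.I)
      = (((p.1 ^ 2 - p.2 ^ 2 : ℝ)) : ℂ) + ((p.1 * p.2 : ℝ) : ℂ) * (2 * Complex.I) := by
    intro p
    push_cast
    linear_combination (p.2 : ℂ) ^ 2 * Complex.I_sq
  simp_rw [e]
  rw [integral_add ((h.comp_fst _).sub (h.comp_snd _)).ofReal ((hm.mul_prod hm).ofReal.mul_const _),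
    integral_mul_const, integral_complex_ofReal, integral_complex_ofReal,
    integral_sub (h.comp_fst _) (h.comp_snd _), integral_prod_mul (fun x : ℝ => x) fun x : ℝ => x]
  have h1 := integral_fun_fst (μ := gaussianReal 0 (v / 2).toNNReal)
    (ν := gaussianReal 0 (v / 2).toNNReal) (fun x : ℝ => x ^ 2)
  have h2 := integral_fun_snd (μ := gaussianReal 0 (v / 2).toNNReal)
    (ν := gaussianReal 0 (v / 2).toNNReal) (fun x : ℝ => x ^ 2)
  rw [h1, h2]
  simp [integral_id_gaussianReal]

theorem integral_mul_conj_complexGaussian {v : ℝ} (hv : 0 ≤ v) :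
    ∫ z, z * conj z ∂complexGaussian v = v := by
  rw [integral_complexGaussian (fun z => z * conj z)]
  have h := integrable_gaussianReal_sq (v / 2).toNNReal
  have e : ∀ p : ℝ × ℝ, ((p.1 : ℂ) + p.2 * Complex.I) * conj (p.1 + p.2 * Complex.I : ℂ)
      = ((p.1 ^ 2 + p.2 ^ 2 : ℝ) : ℂ) := by
    intro p
    rw [Complex.mul_conj, Complex.normSq_add_mul_I]
  simp_rw [e]
  rw [integral_complex_ofReal, integral_add (h.comp_fst _) (h.comp_snd _)]
  have h1 := integral_fun_fst (μ := gaussianReal 0 (v / 2).toNNReal)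
    (ν := gaussianReal 0 (v / 2).toNNReal) (fun x : ℝ => x ^ 2)
  have h2 := integral_fun_snd (μ := gaussianReal 0 (v / 2).toNNReal)
    (ν := gaussianReal 0 (v / 2).toNNReal) (fun x : ℝ => x ^ 2)
  rw [h1, h2]
  simp only [integral_gaussianReal_sq, probReal_univ, one_smul,
    Real.coe_toNNReal _ (div_nonneg hv zero_le_two), add_halves]

/-! ### Linear combinations of the sources and their covariance algebra. -/

variable {Ω : Type*} {ι : Type*}

/-- The random variable `∑ a x * Z x`. -/
def lin (Z : ι → Ω → ℂ) (a : ι →₀ ℂ) (ω : Ω) : ℂ :=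
  Finsupp.linearCombination ℂ (fun x => Z x ω) a

/-- The covariance `∑ a x * conj (b x) * v x` of `lin Z a` and `lin Z b`. -/
def covar (v : ι → ℝ) (a b : ι →₀ ℂ) : ℂ :=
  Finsupp.linearCombination ℂ (fun x => conj (b x) * (v x : ℂ)) a

section Algebra

variable (Z : ι → Ω → ℂ) (v : ι → ℝ) (a b c : ι →₀ ℂ) (z : ℂ) (ω : Ω)

theorem lin_eq_sum : lin Z a ω = ∑ x ∈ a.support, a x * Z x ω := rfl

theorem lin_add : lin Z (a + b) ω = lin Z a ω + lin Z b ω := map_add _ _ _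

theorem lin_sub : lin Z (a - b) ω = lin Z a ω - lin Z b ω := map_sub _ _ _

theorem lin_smul : lin Z (z • a) ω = z * lin Z a ω := map_smul _ _ _

theorem lin_sum {J : Type*} (s : Finset J) (f : J → ι →₀ ℂ) :
    lin Z (∑ j ∈ s, f j) ω = ∑ j ∈ s, lin Z (f j) ω := map_sum _ _ _

theorem lin_single (x : ι) : lin Z (Finsupp.single x 1) ω = Z x ω := by simp [lin]

theorem covar_eq_sum : covar v a b = ∑ x ∈ a.support, a x * (conj (b x) * v x) := rfl

theorem covar_add_left : covar v (a + b) c = covar v a c + covar v b c := map_add _ _ _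

theorem covar_sub_left : covar v (a - b) c = covar v a c - covar v b c := map_sub _ _ _

theorem covar_smul_left : covar v (z • a) b = z * covar v a b := map_smul _ _ _

theorem covar_sum_left {J : Type*} (s : Finset J) (f : J → ι →₀ ℂ) :
    covar v (∑ j ∈ s, f j) b = ∑ j ∈ s, covar v (f j) b := map_sum _ _ _

theorem covar_single_left (x : ι) : covar v (Finsupp.single x 1) b = conj (b x) * v x := by
  simp [covar]

/-- Each side sums over the support of its own first argument, so both are first extended to the
union of the supports. This symmetry carries every rule for the left argument over to the right. -/
theorem covar_conj : conj (covar v a b) = covar v b a := by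
  classical
  have h1 : ∀ a b : ι →₀ ℂ, covar v a b
      = ∑ x ∈ a.support ∪ b.support, a x * (conj (b x) * v x) := fun a b => by
    rw [covar_eq_sum]
    refine Finset.sum_subset Finset.subset_union_left fun x _ hx => ?_
    rw [Finsupp.notMem_support_iff.1 hx, zero_mul]
  rw [h1, h1, map_sum, Finset.union_comm]
  refine Finset.sum_congr rfl fun x _ => ?_
  simp only [map_mul, Complex.conj_conj, Complex.conj_ofReal]
  ring

theorem covar_add_right : covar v a (b + c) = covar v a b + covar v a c := by
  rw [← covar_conj, covar_add_left, map_add, covar_conj, covar_conj]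

theorem covar_sub_right : covar v a (b - c) = covar v a b - covar v a c := by
  rw [← covar_conj, covar_sub_left, map_sub, covar_conj, covar_conj]

theorem covar_smul_right : covar v a (z • b) = conj z * covar v a b := by
  rw [← covar_conj, covar_smul_left, map_mul, covar_conj]

theorem covar_sum_right {J : Type*} (s : Finset J) (f : J → ι →₀ ℂ) :
    covar v a (∑ j ∈ s, f j) = ∑ j ∈ s, covar v a (f j) := by
  rw [← covar_conj, covar_sum_left, map_sum]
  simp_rw [covar_conj]

theorem covar_single_right (x : ι) : covar v a (Finsupp.single x 1) = a x * v x := by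
  rw [← covar_conj, covar_single_left]
  simp

theorem covar_eq_zero_symm {a b : ι →₀ ℂ} (h : covar v a b = 0) : covar v b a = 0 := by
  rw [← covar_conj, h, map_zero]

end Algebra

/-! ### Joint Gaussianity: zero covariance gives independence. -/

variable [MeasurableSpace Ω] {μ : Measure Ω}

/-- Independent centered circularly symmetric complex Gaussian variables with variances `v`. -/
structure IsGaussianSources (Z : ι → Ω → ℂ) (v : ι → ℝ) (μ : Measure Ω) : Prop where
  nonneg : ∀ x, 0 ≤ v x
  meas : ∀ x, Measurable (Z x)
  law : ∀ x, μ.map (Z x) = complexGaussian (v x)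
  indep : iIndepFun Z μ

namespace IsGaussianSources

variable {Z : ι → Ω → ℂ} {v : ι → ℝ} (h : IsGaussianSources Z v μ)

include h

theorem isProbabilityMeasure : IsProbabilityMeasure μ := h.indep.isProbabilityMeasure

theorem hasGaussianLaw (x : ι) : HasGaussianLaw (Z x) μ := by
  refine ⟨?_⟩
  rw [h.law]
  infer_instance

theorem sources_jointlyGaussian : IsGaussianProcess Z μ where
  hasGaussianLaw I := by
    have h1 : iIndepFun (fun i : I => Z i) μ := h.indep.precomp Subtype.val_injective
    exact h1.hasGaussianLaw fun i => h.hasGaussianLaw i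

theorem measurable_lin (a : ι →₀ ℂ) : Measurable (lin Z a) := by
  have : lin Z a = fun ω => ∑ x ∈ a.support, a x * Z x ω := rfl
  rw [this]
  exact Finset.measurable_fun_sum _ fun x _ => (h.meas x).const_mul _

/-- Each combination is a continuous real-linear image of finitely many sources. -/
theorem lin_jointlyGaussian : IsGaussianProcess (fun a => lin Z a) μ := by
  refine IsGaussianProcess.of_isGaussianProcess h.sources_jointlyGaussian fun a => ⟨a.support,
    ∑ x : a.support, (a x) • ContinuousLinearMap.proj (R := ℝ) (φ := fun _ : a.support => ℂ) x,
    fun ω => ?_⟩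
  rw [lin_eq_sum, ← Finset.sum_coe_sort]
  simp

theorem memLp_source (x : ι) : MemLp (Z x) 2 μ := (h.hasGaussianLaw x).memLp_two

theorem memLp_lin (a : ι →₀ ℂ) : MemLp (lin Z a) 2 μ :=
  (h.lin_jointlyGaussian.hasGaussianLaw_eval a).memLp_two

theorem integral_source (x : ι) : ∫ ω, Z x ω ∂μ = 0 := by
  rw [← integral_id_complexGaussian (v x), ← h.law x, integral_map (h.meas x).aemeasurable]
  exact aestronglyMeasurable_id

theorem integral_source_mul (x y : ι) : ∫ ω, Z x ω * Z y ω ∂μ = 0 := by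
  by_cases hxy : x = y
  · subst hxy
    rw [← integral_mul_self_complexGaussian (v x), ← h.law x,
      integral_map (h.meas x).aemeasurable (by fun_prop)]
  · rw [(h.indep.indepFun hxy).integral_fun_mul_eq_mul_integral
      (h.meas x).aestronglyMeasurable (h.meas y).aestronglyMeasurable, h.integral_source, zero_mul]

theorem integral_source_mul_conj (x y : ι) [Decidable (y = x)] :
    ∫ ω, Z x ω * conj (Z y ω) ∂μ = if y = x then (v x : ℂ) else 0 := by
  split_ifs with hxy
  · subst hxy
    rw [← integral_mul_conj_complexGaussian (h.nonneg y), ← h.law y,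
      integral_map (h.meas y).aemeasurable (by fun_prop)]
  · have := ((h.indep.indepFun (Ne.symm hxy)).comp (φ := id) (ψ := fun z : ℂ => conj z)
      measurable_id (by fun_prop)).integral_fun_mul_eq_mul_integral
      (h.meas x).aestronglyMeasurable (by have := h.meas y; fun_prop)
    simp only [Function.comp_def, id, h.integral_source, zero_mul] at this
    exact this

theorem integral_lin (a : ι →₀ ℂ) : ∫ ω, lin Z a ω ∂μ = 0 := by
  have := h.isProbabilityMeasure
  simp_rw [lin_eq_sum]
  rw [integral_finsetSum _ fun x _ => ((h.memLp_source x).integrable (by simp)).const_mul _]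
  simp [integral_const_mul, h.integral_source]

theorem integral_lin_mul (a b : ι →₀ ℂ) : ∫ ω, lin Z a ω * lin Z b ω ∂μ = 0 := by
  have hi : ∀ x y, Integrable (fun ω => (a x * Z x ω) * (b y * Z y ω)) μ := fun x y =>
    ((h.memLp_source x).const_mul (a x)).integrable_mul ((h.memLp_source y).const_mul (b y))
  simp_rw [lin_eq_sum, Finset.sum_mul_sum]
  rw [integral_finsetSum _ fun x _ => integrable_finsetSum _ fun y _ => hi x y]
  refine Finset.sum_eq_zero fun x _ => ?_
  rw [integral_finsetSum _ fun y _ => hi x y]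
  refine Finset.sum_eq_zero fun y _ => ?_
  simp_rw [mul_mul_mul_comm _ (Z x _)]
  rw [integral_const_mul, h.integral_source_mul, mul_zero]

theorem integral_lin_mul_conj (a b : ι →₀ ℂ) :
    ∫ ω, lin Z a ω * conj (lin Z b ω) ∂μ = covar v a b := by
  classical
  have hi : ∀ x y, Integrable (fun ω => (a x * Z x ω) * (conj (b y) * conj (Z y ω))) μ := fun x y =>
    ((h.memLp_source x).const_mul (a x)).integrable_mul
      ((h.memLp_source y).star.const_mul (conj (b y)))
  rw [covar_eq_sum]
  simp_rw [lin_eq_sum, map_sum, map_mul, Finset.sum_mul_sum]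
  rw [integral_finsetSum _ fun x _ => integrable_finsetSum _ fun y _ => hi x y]
  refine Finset.sum_congr rfl fun x _ => ?_
  rw [integral_finsetSum _ fun y _ => hi x y]
  simp_rw [mul_mul_mul_comm _ (Z x _)]
  simp_rw [integral_const_mul, h.integral_source_mul_conj, mul_ite, mul_zero]
  rw [Finset.sum_ite_eq']
  split_ifs with hx
  · ring
  · rw [Finsupp.notMem_support_iff.1 hx]
    simp

theorem integral_norm_sq_lin (a : ι →₀ ℂ) {r : ℝ} (ha : covar v a a = r) :
    ∫ ω, ‖lin Z a ω‖ ^ 2 ∂μ = r := by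
  rw [← Complex.ofReal_inj, ofReal_integral_norm_sq, h.integral_lin_mul_conj, ha]

theorem integral_re_lin (a : ι →₀ ℂ) : ∫ ω, (lin Z a ω).re ∂μ = 0 := by
  have := h.isProbabilityMeasure
  have := integral_re (𝕜 := ℂ) ((h.memLp_lin a).integrable (by simp))
  simp only [RCLike.re_eq_complex_re, h.integral_lin] at this
  simpa using this

/-- `Re z · Re w = Re (z w + z conj w) / 2`, and the mean of `z w` vanishes by circular symmetry. -/
theorem covariance_re_lin (a b : ι →₀ ℂ) :
    cov[fun ω => (lin Z a ω).re, fun ω => (lin Z b ω).re; μ] = (covar v a b).re / 2 := by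
  have := h.isProbabilityMeasure
  have e : ∀ ω, (lin Z a ω).re * (lin Z b ω).re
      = (lin Z a ω * lin Z b ω + lin Z a ω * conj (lin Z b ω)).re / 2 := by
    intro ω
    simp [Complex.mul_re]
  rw [covariance, h.integral_re_lin, h.integral_re_lin]
  simp_rw [sub_zero, e]
  have h1 : Integrable (fun ω => lin Z a ω * lin Z b ω) μ :=
    (h.memLp_lin a).integrable_mul (h.memLp_lin b)
  have h2 : Integrable (fun ω => lin Z a ω * conj (lin Z b ω)) μ :=
    MemLp.integrable_mul_conj (h.memLp_lin a) (h.memLp_lin b)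
  have h3 := integral_re (𝕜 := ℂ) (h1.add h2)
  simp only [RCLike.re_eq_complex_re, Pi.add_apply] at h3
  rw [integral_div, h3, integral_add h1 h2, h.integral_lin_mul, h.integral_lin_mul_conj, zero_add]

/-- The real inner product of `z` with a combination is the real part of the combination scaled by
`conj z`. Zero complex covariance thus kills all real covariances, and joint Gaussianity turns this
into independence. -/
theorem indepFun_lin {I J : Type*} {a : I → ι →₀ ℂ} {b : J → ι →₀ ℂ}
    (hab : ∀ i j, covar v (a i) (b j) = 0) :
    IndepFun (fun ω i => lin Z (a i) ω) (fun ω j => lin Z (b j) ω) μ := by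
  have hp : IsGaussianProcess (Sum.elim (fun i => lin Z (a i)) fun j => lin Z (b j)) μ := by
    have e : Sum.elim (fun i => lin Z (a i)) (fun j => lin Z (b j))
        = (fun c => lin Z c) ∘ Sum.elim a b := by
      funext k
      cases k <;> rfl
    rw [e]
    exact h.lin_jointlyGaussian.comp_right _
  refine hp.indepFun_of_covariance_inner (fun i => (h.measurable_lin _).aemeasurable)
    (fun i => (h.measurable_lin _).aemeasurable) fun i j z w => ?_
  have e : ∀ (z : ℂ) (c : ι →₀ ℂ) (ω : Ω), inner ℝ z (lin Z c ω) = (lin Z (conj z • c) ω).re := by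
    intro z c ω
    rw [Complex.inner, lin_smul, mul_comm]
  simp_rw [e]
  rw [h.covariance_re_lin, covar_smul_left, covar_smul_right, hab]
  simp

theorem iIndepFun_lin {I : Type*} {a : I → ι →₀ ℂ}
    (ha : ∀ i j, i ≠ j → covar v (a i) (a j) = 0) : iIndepFun (fun i => lin Z (a i)) μ := by
  -- Each variable is viewed as a process indexed by `Unit`, the form that the independence
  -- criterion takes.
  have hp : IsGaussianProcess (fun (p : (_ : I) × Unit) ω => lin Z (a p.1) ω) μ :=
    h.lin_jointlyGaussian.comp_right fun p : (_ : I) × Unit => a p.1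
  have e : ∀ (z : ℂ) (c : ι →₀ ℂ) (ω : Ω), inner ℝ z (lin Z c ω) = (lin Z (conj z • c) ω).re := by
    intro z c ω
    rw [Complex.inner, lin_smul, mul_comm]
  have := IsGaussianProcess.iIndepFun_of_covariance_inner
    (X := fun (i : I) (_ : Unit) ω => lin Z (a i) ω) hp
    (fun i _ => (h.measurable_lin _).aemeasurable) fun i j hij _ _ z w => by
      simp_rw [e]
      rw [h.covariance_re_lin, covar_smul_left, covar_smul_right, ha i j hij]
      simp
  exact this.comp (fun _ (f : Unit → ℂ) => f ()) fun _ => by fun_prop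

theorem map_re_lin (a : ι →₀ ℂ) {r : ℝ} (ha : covar v a a = r) :
    μ.map (fun ω => (lin Z a ω).re) = gaussianReal 0 (r / 2).toNNReal := by
  have := h.isProbabilityMeasure
  have h1 : HasGaussianLaw (fun ω => (lin Z a ω).re) μ :=
    (h.lin_jointlyGaussian.hasGaussianLaw_eval a).map_fun Complex.reCLM
  have hm := h.measurable_lin a
  rw [h1.map_eq_gaussianReal, h.integral_re_lin, ← covariance_self (by fun_prop),
    h.covariance_re_lin, ha, Complex.ofReal_re]

/-- `Im z = Re (-i z)`, and multiplication by `-i` preserves the variance. -/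
theorem map_im_lin (a : ι →₀ ℂ) {r : ℝ} (ha : covar v a a = r) :
    μ.map (fun ω => (lin Z a ω).im) = gaussianReal 0 (r / 2).toNNReal := by
  have h1 : covar v ((-Complex.I) • a) ((-Complex.I) • a) = r := by
    rw [covar_smul_left, covar_smul_right, ha]
    simp [← mul_assoc]
  rw [← h.map_re_lin _ h1]
  simp only [lin_smul]
  simp

theorem indepFun_re_im (a : ι →₀ ℂ) {r : ℝ} (ha : covar v a a = r) :
    IndepFun (fun ω => (lin Z a ω).re) (fun ω => (lin Z a ω).im) μ := by
  have e : (fun ω => (lin Z a ω).im) = fun ω => (lin Z ((-Complex.I) • a) ω).re := by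
    ext ω
    rw [lin_smul]
    simp
  have h1 : HasGaussianLaw (fun ω => ((lin Z a ω).re, (lin Z a ω).im)) μ :=
    (h.lin_jointlyGaussian.hasGaussianLaw_eval a).map_fun
      (Complex.reCLM.prod Complex.imCLM)
  refine h1.indepFun_of_covariance_eq_zero ?_
  rw [e, h.covariance_re_lin, covar_smul_right, ha]
  simp

/-- The real part is already a nondegenerate Gaussian, hence without atoms. -/
theorem measure_lin_preimage_singleton (a : ι →₀ ℂ) {r : ℝ} (ha : covar v a a = r) (hr : 0 < r)
    (z : ℂ) : μ (lin Z a ⁻¹' {z}) = 0 := by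
  have h1 : μ ((fun ω => (lin Z a ω).re) ⁻¹' {z.re}) = 0 := by
    have hm := h.measurable_lin a
    rw [← Measure.map_apply (by fun_prop) (measurableSet_singleton _), h.map_re_lin a ha]
    have := nullSingletonClass_gaussianReal (μ := 0) (v := (r / 2).toNNReal)
      (by simpa using hr)
    exact measure_singleton _
  refine measure_mono_null ?_ h1
  intro ω hω
  simp only [Set.mem_preimage, Set.mem_singleton_iff] at hω ⊢
  rw [hω]

end IsGaussianSources

end

/-! ### Laplace transforms and the inverse moment of the correlator energy. -/

section
-- The variance is `r / 2`, so the density contributes `exp (-x² / r)` and the integrand is a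
-- Gaussian with exponent `s + 1/r`.
theorem lintegral_exp_neg_sq_gaussianReal {r s : ℝ} (hr : 0 < r) (hs : 0 ≤ s) :
    ∫⁻ x, ENNReal.ofReal (Real.exp (-s * x ^ 2)) ∂gaussianReal 0 (r / 2).toNNReal
      = ENNReal.ofReal (√(1 / (1 + s * r))) := by
  have hv : (r / 2).toNNReal ≠ 0 := by simpa using hr
  have hint : Integrable (fun x : ℝ => Real.exp (-s * x ^ 2)) (gaussianReal 0 (r / 2).toNNReal) := by
    refine Integrable.of_bound (C := 1) (by fun_prop) (.of_forall fun x => ?_)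
    rw [Real.norm_eq_abs, Real.abs_exp, Real.exp_le_one_iff]
    nlinarith [mul_nonneg hs (sq_nonneg x)]
  rw [← ofReal_integral_eq_lintegral_ofReal hint (.of_forall fun x => (Real.exp_pos _).le),
    integral_gaussianReal_eq_integral_smul hv]
  congr 1
  have e : ∀ x : ℝ, gaussianPDFReal 0 (r / 2).toNNReal x • Real.exp (-s * x ^ 2)
      = (√(2 * Real.pi * (r / 2)))⁻¹ * Real.exp (-(s + 1 / r) * x ^ 2) := by
    intro x
    rw [gaussianPDFReal, Real.coe_toNNReal _ (by positivity), smul_eq_mul, mul_assoc, ← Real.exp_add]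
    congr 2
    field_simp
    ring
  simp_rw [e]
  rw [integral_const_mul, integral_gaussian, ← Real.sqrt_inv, ← Real.sqrt_mul (by positivity)]
  congr 1
  have := Real.pi_pos
  field_simp
  ring

variable {Ω : Type*} [MeasurableSpace Ω] {μ : Measure Ω} {ι : Type*} {Z : ι → Ω → ℂ} {v : ι → ℝ}

theorem IsGaussianSources.lintegral_exp_neg_norm_sq_lin (h : IsGaussianSources Z v μ) (a : ι →₀ ℂ)
    {r s : ℝ} (ha : covar v a a = r) (hr : 0 < r) (hs : 0 ≤ s) :
    ∫⁻ ω, ENNReal.ofReal (Real.exp (-s * ‖lin Z a ω‖ ^ 2)) ∂μ = ENNReal.ofReal (1 / (1 + s * r)) := by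
  have hm := h.measurable_lin a
  have e : ∀ ω, ENNReal.ofReal (Real.exp (-s * ‖lin Z a ω‖ ^ 2))
      = ENNReal.ofReal (Real.exp (-s * (lin Z a ω).re ^ 2))
        * ENNReal.ofReal (Real.exp (-s * (lin Z a ω).im ^ 2)) := by
    intro ω
    rw [← ENNReal.ofReal_mul (Real.exp_pos _).le, ← Real.exp_add, ← Complex.normSq_eq_norm_sq,
      Complex.normSq_apply]
    ring_nf
  have hf : Measurable fun x : ℝ => ENNReal.ofReal (Real.exp (-s * x ^ 2)) := by fun_prop
  have hind : IndepFun (fun ω => ENNReal.ofReal (Real.exp (-s * (lin Z a ω).re ^ 2)))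
      (fun ω => ENNReal.ofReal (Real.exp (-s * (lin Z a ω).im ^ 2))) μ :=
    (h.indepFun_re_im a ha).comp hf hf
  simp_rw [e]
  have h1 := lintegral_mul_eq_lintegral_mul_lintegral_of_indepFun (by fun_prop) (by fun_prop) hind
  simp only [Pi.mul_apply] at h1
  rw [h1, ← lintegral_map (f := fun x => ENNReal.ofReal (Real.exp (-s * x ^ 2)))
      (g := fun ω => (lin Z a ω).re) hf (by fun_prop),
    ← lintegral_map (f := fun x => ENNReal.ofReal (Real.exp (-s * x ^ 2)))
      (g := fun ω => (lin Z a ω).im) hf (by fun_prop), h.map_re_lin a ha, h.map_im_lin a ha,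
    lintegral_exp_neg_sq_gaussianReal hr hs, ← ENNReal.ofReal_mul (Real.sqrt_nonneg _),
    Real.mul_self_sqrt (by positivity)]

/-- Equality holds for `x > 0`. At `x = 0` the left side is `0` by the convention for division and
the right side is infinite, hence only an inequality. -/
theorem ofReal_one_div_le_lintegral_exp {x : ℝ} (hx : 0 ≤ x) :
    ENNReal.ofReal (1 / x) ≤ ∫⁻ s in Set.Ioi (0 : ℝ), ENNReal.ofReal (Real.exp (-s * x)) := by
  rcases hx.eq_or_lt with rfl | hx
  · simp
  · have hi : IntegrableOn (fun s : ℝ => Real.exp (-s * x)) (Set.Ioi 0) := by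
      have := integrableOn_exp_mul_Ioi (neg_lt_zero.2 hx) 0
      refine this.congr_fun (fun s _ => ?_) measurableSet_Ioi
      ring_nf
    rw [← ofReal_integral_eq_lintegral_ofReal hi (.of_forall fun s => (Real.exp_pos _).le)]
    have : ∫ s in Set.Ioi (0 : ℝ), Real.exp (-s * x) = 1 / x := by
      have := integral_exp_mul_Ioi (neg_lt_zero.2 hx) 0
      have e : ∀ s : ℝ, -s * x = -x * s := fun s => by ring
      simp_rw [e]
      rw [this]
      simp
    rw [this]

/-- By an explicit antiderivative. The integral diverges for `M = 1`; this is where two antennas are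
needed. -/
theorem lintegral_one_div_one_add_pow {r : ℝ} (hr : 0 < r) {M : ℕ} (hM : 2 ≤ M) :
    ∫⁻ s in Set.Ioi (0 : ℝ), ENNReal.ofReal ((1 / (1 + s * r)) ^ M)
      = ENNReal.ofReal (1 / (r * (M - 1))) := by
  obtain ⟨n, rfl⟩ : ∃ n, M = n + 2 := ⟨M - 2, by omega⟩
  have hd : ∀ s ∈ Set.Ici (0 : ℝ), HasDerivAt
      (fun s : ℝ => -(1 / (r * (n + 1))) * ((1 + s * r)⁻¹) ^ (n + 1))
      ((1 / (1 + s * r)) ^ (n + 2)) s := by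
    intro s hs
    have hs0 : 0 < 1 + s * r := by
      have : 0 ≤ s := hs
      positivity
    have h1 : HasDerivAt (fun s : ℝ => 1 + s * r) r s := by
      simpa using ((hasDerivAt_id s).mul_const r).const_add 1
    have h2 := ((h1.inv hs0.ne').pow (n + 1)).const_mul (-(1 / (r * (n + 1))))
    have e : (1 / (1 + s * r)) ^ (n + 2) = -(1 / (r * (n + 1))) *
        (((n + 1 : ℕ) : ℝ) * ((1 + s * r)⁻¹) ^ (n + 1 - 1) * (-r / (1 + s * r) ^ 2)) := by
      rw [Nat.add_sub_cancel, one_div, inv_pow, inv_pow, pow_add]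
      push_cast
      field_simp
    rw [e]
    exact h2
  have ht : Filter.Tendsto (fun s : ℝ => -(1 / (r * (n + 1))) * ((1 + s * r)⁻¹) ^ (n + 1))
      Filter.atTop (nhds 0) := by
    have h1 : Filter.Tendsto (fun s : ℝ => 1 + s * r) Filter.atTop Filter.atTop :=
      Filter.tendsto_atTop_add_const_left _ _ (Filter.tendsto_id.atTop_mul_const hr)
    simpa using ((h1.inv_tendsto_atTop.pow (n + 1)).const_mul (-(1 / (r * (n + 1)))))
  have hnn : ∀ s ∈ Set.Ioi (0 : ℝ), 0 ≤ (1 / (1 + s * r)) ^ (n + 2) := by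
    intro s hs
    have : (0 : ℝ) < s := hs
    positivity
  have hi := integrableOn_Ioi_deriv_of_nonneg' hd hnn ht
  have hval := integral_Ioi_of_hasDerivAt_of_nonneg' hd hnn ht
  rw [← ofReal_integral_eq_lintegral_ofReal hi ((ae_restrict_iff' measurableSet_Ioi).2
    (.of_forall hnn)), hval]
  congr 1
  push_cast
  simp
  left
  ring

/-- Writing `1/x` as the integral of `exp (-s x)` and swapping integrals leaves the Laplace
transform of the energy, which factors over the independent antennas into `(1 / (1 + s r))^M`. -/
theorem IsGaussianSources.lintegral_one_div_sum_norm_sq_le (h : IsGaussianSources Z v μ) {M : ℕ}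
    (hM : 2 ≤ M) {a : Fin M → ι →₀ ℂ} {r : ℝ} (hr : 0 < r)
    (ha : ∀ i j, covar v (a i) (a j) = if i = j then (r : ℂ) else 0) :
    ∫⁻ ω, ENNReal.ofReal (1 / ∑ i, ‖lin Z (a i) ω‖ ^ 2) ∂μ
      ≤ ENNReal.ofReal (1 / (r * (M - 1))) := by
  have := h.isProbabilityMeasure
  have hm := fun i => h.measurable_lin (a i)
  have hind : iIndepFun (fun i => lin Z (a i)) μ :=
    h.iIndepFun_lin fun i j hij => by rw [ha, if_neg hij]
  have hlap : ∀ s ∈ Set.Ioi (0 : ℝ),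
      ∫⁻ ω, ENNReal.ofReal (Real.exp (-s * ∑ i, ‖lin Z (a i) ω‖ ^ 2)) ∂μ
        = ENNReal.ofReal ((1 / (1 + s * r)) ^ M) := by
    intro s hs
    have hs0 : (0 : ℝ) < s := hs
    have e : ∀ ω, ENNReal.ofReal (Real.exp (-s * ∑ i, ‖lin Z (a i) ω‖ ^ 2))
        = ∏ i, ENNReal.ofReal (Real.exp (-s * ‖lin Z (a i) ω‖ ^ 2)) := by
      intro ω
      rw [Finset.mul_sum, Real.exp_sum, ENNReal.ofReal_prod_of_nonneg fun i _ => (Real.exp_pos _).le]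
    simp_rw [e]
    have h2 : iIndepFun (fun i ω => ENNReal.ofReal (Real.exp (-s * ‖lin Z (a i) ω‖ ^ 2))) μ :=
      hind.comp (fun _ z => ENNReal.ofReal (Real.exp (-s * ‖z‖ ^ 2))) fun _ => by fun_prop
    rw [lintegral_prod_eq_prod_lintegral_of_indepFun Finset.univ _ h2 fun i => by fun_prop]
    have h3 : ∀ i, ∫⁻ ω, ENNReal.ofReal (Real.exp (-s * ‖lin Z (a i) ω‖ ^ 2)) ∂μ
        = ENNReal.ofReal (1 / (1 + s * r)) := fun i =>
      h.lintegral_exp_neg_norm_sq_lin (a i) (by rw [ha, if_pos rfl]) hr hs0.le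
    simp_rw [h3]
    rw [Finset.prod_const, Finset.card_univ, Fintype.card_fin, ENNReal.ofReal_pow (by positivity)]
  calc ∫⁻ ω, ENNReal.ofReal (1 / ∑ i, ‖lin Z (a i) ω‖ ^ 2) ∂μ
      ≤ ∫⁻ ω, ∫⁻ s in Set.Ioi (0 : ℝ),
          ENNReal.ofReal (Real.exp (-s * ∑ i, ‖lin Z (a i) ω‖ ^ 2)) ∂volume ∂μ :=
        lintegral_mono fun ω => ofReal_one_div_le_lintegral_exp (by positivity)
    _ = ∫⁻ s in Set.Ioi (0 : ℝ), ∫⁻ ω,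
          ENNReal.ofReal (Real.exp (-s * ∑ i, ‖lin Z (a i) ω‖ ^ 2)) ∂μ ∂volume :=
        lintegral_lintegral_swap (by fun_prop)
    _ = ∫⁻ s in Set.Ioi (0 : ℝ), ENNReal.ofReal ((1 / (1 + s * r)) ^ M) :=
        setLIntegral_congr_fun measurableSet_Ioi hlap
    _ = _ := lintegral_one_div_one_add_pow hr hM

end

/-! ### Covariances of channels, correlator outputs and residual channels. -/

section
variable {C NG M τ : ℕ}

namespace Network

variable (N : Network C NG M τ)

/-- Coefficients of an entry of the fast fading vector in slot `s`. -/
def hCoef (N : Network C NG M τ) (l : Fin C) (k : Fin NG) (c : Fin C) (i : Fin M) :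
    ℕ → (Source C NG M τ →₀ ℂ)
  | 0 => Finsupp.single (.fading l k c i) 1
  | s + 1 => (N.ρ l k c : ℂ) • hCoef N l k c i s + Finsupp.single (.innovation l k c (s + 1) i) 1

/-- Coefficients of an entry of a channel vector in slot `s`. -/
def gCoef (l : Fin C) (k : Fin NG) (c : Fin C) (i : Fin M) (s : ℕ) : Source C NG M τ →₀ ℂ :=
  (√(N.β l k c) : ℂ) • N.hCoef l k c i s

/-- Coefficients of the correlated pilot noise, scaled to the channel. -/
def nCoef (l : Fin C) (k : Fin NG) (i : Fin M) (s : ℕ) : Source C NG M τ →₀ ℂ :=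
  (√N.Pp : ℂ)⁻¹ • ∑ j, N.q s k j • Finsupp.single (.pilotNoise l s i j) 1

/-- Coefficients of an entry of the scaled correlator output `Yp q / √Pp`. -/
def yCoef (l : Fin C) (k : Fin NG) (i : Fin M) (s : ℕ) : Source C NG M τ →₀ ℂ :=
  ∑ b, N.gCoef l k b i s + N.nCoef l k i s

/-- The variance of an entry of the scaled correlator output. -/
def yVar (l : Fin C) (k : Fin NG) : ℝ := 1 / N.Pp + ∑ b, N.β l k b

/-- Coefficients of an entry of the part of the channel in slot `t` that the estimate made `d k`
slots before leaves unknown to the BS when it detects group `k`. -/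
def vCoef (t : ℕ) (d : Fin NG → ℕ) (l : Fin C) (k : Fin NG) (kc : Fin NG × Fin C) (i : Fin M) :
    Source C NG M τ →₀ ℂ :=
  if kc.1 = k then N.gCoef l k kc.2 i t
      - ((N.ρ l k kc.2 ^ d k * (N.β l k kc.2 / N.yVar l k) : ℝ) : ℂ) • N.yCoef l k i (t - d k)
  else N.gCoef l kc.1 kc.2 i t

/-- The variance of the variable with coefficients `vCoef`. -/
def vVar (d : Fin NG → ℕ) (l : Fin C) (k : Fin NG) (kc : Fin NG × Fin C) : ℝ :=
  if kc.1 = k then N.β l k kc.2 - N.ρ l k kc.2 ^ (2 * d k) * (N.β l k kc.2 ^ 2 / N.yVar l k)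
  else N.β l kc.1 kc.2

theorem yVar_pos (l : Fin C) (k : Fin NG) : 0 < N.yVar l k := by
  have := N.Pp_pos
  have : 0 ≤ ∑ b, N.β l k b := Finset.sum_nonneg fun b _ => (N.β_pos l k b).le
  have : 0 < 1 / N.Pp := by positivity
  rw [yVar]
  linarith

/-- Causality: the fading up to slot `s` does not involve later innovations. -/
theorem hCoef_innovation_of_lt {l : Fin C} {k : Fin NG} {c : Fin C} {i : Fin M} {s : ℕ}
    {l' : Fin C} {k' : Fin NG} {c' : Fin C} {i' : Fin M} {s' : ℕ} (hs : s < s') :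
    N.hCoef l k c i s (.innovation l' k' c' s' i') = 0 := by
  induction s with
  | zero => simp [hCoef]
  | succ s ih =>
    rw [hCoef, Finsupp.add_apply, Finsupp.smul_apply, ih (by omega), Finsupp.single_apply_eq_zero.2]
    · simp
    · intro h
      simp only [Source.innovation.injEq] at h
      omega

theorem hCoef_fading_of_ne {l : Fin C} {k : Fin NG} {c : Fin C} {i : Fin M} {s : ℕ}
    {k' : Fin NG} {c' : Fin C} {i' : Fin M} (hne : ¬ (k = k' ∧ c = c' ∧ i = i')) :
    N.hCoef l k c i s (.fading l k' c' i') = 0 := by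
  induction s with
  | zero =>
    rw [hCoef, Finsupp.single_apply_eq_zero.2]
    intro h
    simp only [Source.fading.injEq] at h
    exact absurd ⟨h.2.1.symm, h.2.2.1.symm, h.2.2.2.symm⟩ hne
  | succ s ih => simp [hCoef, ih]

theorem hCoef_innovation_of_ne {l : Fin C} {k : Fin NG} {c : Fin C} {i : Fin M} {s : ℕ}
    {k' : Fin NG} {c' : Fin C} {i' : Fin M} {s' : ℕ} (hne : ¬ (k = k' ∧ c = c' ∧ i = i')) :
    N.hCoef l k c i s (.innovation l k' c' s' i') = 0 := by
  induction s with
  | zero => simp [hCoef]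
  | succ s ih =>
    rw [hCoef, Finsupp.add_apply, Finsupp.smul_apply, ih, Finsupp.single_apply_eq_zero.2]
    · simp
    · intro h
      simp only [Source.innovation.injEq] at h
      exact absurd ⟨h.2.1.symm, h.2.2.1.symm, h.2.2.2.2.symm⟩ hne

theorem hCoef_pilotNoise {l : Fin C} {k : Fin NG} {c : Fin C} {i : Fin M} {s : ℕ}
    {l' : Fin C} {s' : ℕ} {i' : Fin M} {j : Fin τ} :
    N.hCoef l k c i s (.pilotNoise l' s' i' j) = 0 := by
  induction s with
  | zero => simp [hCoef]
  | succ s ih => simp [hCoef, ih]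

theorem hCoef_dataNoise {l : Fin C} {k : Fin NG} {c : Fin C} {i : Fin M} {s : ℕ}
    {l' : Fin C} {i' : Fin M} : N.hCoef l k c i s (.dataNoise l' i') = 0 := by
  induction s with
  | zero => simp [hCoef]
  | succ s ih => simp [hCoef, ih]

/-- Distinct users or antennas draw on disjoint sources. A single BS suffices, since the SINR of a
user only involves its own BS. -/
theorem covar_hCoef_of_ne {l : Fin C} {k k' : Fin NG} {c c' : Fin C} {i i' : Fin M} (s s' : ℕ)
    (hne : ¬ (k = k' ∧ c = c' ∧ i = i')) :
    covar N.sourceVariance (N.hCoef l k c i s) (N.hCoef l k' c' i' s') = 0 := by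
  induction s' with
  | zero => rw [hCoef, covar_single_right, N.hCoef_fading_of_ne hne, zero_mul]
  | succ s' ih =>
    rw [hCoef, covar_add_right, covar_smul_right, ih, covar_single_right,
      N.hCoef_innovation_of_ne hne]
    simp

/-- Stationarity: the new innovation is uncorrelated with the past, and `ρ² + (1 - ρ²) = 1`. -/
theorem covar_hCoef_self (l : Fin C) (k : Fin NG) (c : Fin C) (i : Fin M) (s : ℕ) :
    covar N.sourceVariance (N.hCoef l k c i s) (N.hCoef l k c i s) = 1 := by
  induction s with
  | zero => rw [hCoef, covar_single_right]; simp [sourceVariance]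
  | succ s ih =>
    have h1 : N.hCoef l k c i s (.innovation l k c (s + 1) i) = 0 :=
      N.hCoef_innovation_of_lt (Nat.lt_succ_self s)
    rw [hCoef, covar_add_right, covar_smul_right, covar_single_right, covar_add_left,
      covar_smul_left, ih, covar_single_left, Finsupp.add_apply, Finsupp.smul_apply, h1]
    simp [sourceVariance]
    ring

theorem covar_hCoef_add (l : Fin C) (k : Fin NG) (c : Fin C) (i : Fin M) (s n : ℕ) :
    covar N.sourceVariance (N.hCoef l k c i (s + n)) (N.hCoef l k c i s) = (N.ρ l k c : ℂ) ^ n := by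
  induction n with
  | zero => simp [covar_hCoef_self]
  | succ n ih =>
    have h1 : N.hCoef l k c i s (.innovation l k c (s + n + 1) i) = 0 :=
      N.hCoef_innovation_of_lt (by omega)
    rw [← add_assoc, hCoef, covar_add_left, covar_smul_left, ih, covar_single_left, h1]
    simp [pow_succ']

theorem sqrt_mul_sqrt_ofReal {x : ℝ} (hx : 0 ≤ x) : (√x : ℂ) * (√x : ℂ) = x := by
  rw [← Complex.ofReal_mul, Real.mul_self_sqrt hx]

theorem covar_gCoef {t d : ℕ} (hd : d ≤ t) (l : Fin C) (k k' : Fin NG) (c c' : Fin C)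
    (i i' : Fin M) :
    covar N.sourceVariance (N.gCoef l k c i t) (N.gCoef l k' c' i' (t - d))
      = if k = k' ∧ c = c' ∧ i = i' then ((N.ρ l k c ^ d * N.β l k c : ℝ) : ℂ) else 0 := by
  rw [gCoef, gCoef, covar_smul_left, covar_smul_right]
  split_ifs with hh
  · obtain ⟨rfl, rfl, rfl⟩ := hh
    obtain ⟨s, rfl⟩ : ∃ s, t = s + d := ⟨t - d, by omega⟩
    rw [Nat.add_sub_cancel, covar_hCoef_add, Complex.conj_ofReal, ← mul_assoc,
      sqrt_mul_sqrt_ofReal (N.β_pos l k c).le]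
    push_cast
    ring
  · rw [N.covar_hCoef_of_ne _ _ hh]
    simp

theorem covar_gCoef_self (l : Fin C) (k k' : Fin NG) (c c' : Fin C) (i i' : Fin M) (t : ℕ) :
    covar N.sourceVariance (N.gCoef l k c i t) (N.gCoef l k' c' i' t)
      = if k = k' ∧ c = c' ∧ i = i' then (N.β l k c : ℂ) else 0 := by
  simpa using N.covar_gCoef (Nat.zero_le t) l k k' c c' i i'

theorem covar_gCoef_nCoef (l : Fin C) (k k' : Fin NG) (c : Fin C) (i i' : Fin M) (s t : ℕ) :
    covar N.sourceVariance (N.gCoef l k c i t) (N.nCoef l k' i' s) = 0 := by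
  rw [gCoef, nCoef, covar_smul_left, covar_smul_right, covar_sum_right]
  simp_rw [covar_smul_right, covar_single_right, hCoef_pilotNoise]
  simp

/-- Correlation with a unit-norm pilot preserves the noise variance, which is then divided by `Pp`.
-/
theorem covar_nCoef (l : Fin C) {k : Fin NG} (i i' : Fin M) {s : ℕ} (hk : k ∈ N.trained s) :
    covar N.sourceVariance (N.nCoef l k i s) (N.nCoef l k i' s)
      = if i = i' then ((1 / N.Pp : ℝ) : ℂ) else 0 := by
  classical
  have hP : (√N.Pp : ℂ) * (√N.Pp : ℂ) = N.Pp := sqrt_mul_sqrt_ofReal N.Pp_pos.le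
  have hq := N.q_orthonormal s k hk k hk
  rw [if_pos rfl] at hq
  rw [nCoef, nCoef, covar_smul_left, covar_smul_right, covar_sum_left]
  simp_rw [covar_sum_right, covar_smul_left, covar_smul_right, covar_single_left,
    Finsupp.single_apply, Source.pilotNoise.injEq]
  by_cases hi : i = i'
  · subst hi
    simp only [sourceVariance, true_and, if_true, Complex.ofReal_one, mul_one, apply_ite conj,
      map_one, map_zero, mul_ite, mul_zero, Finset.sum_ite_eq', Finset.mem_univ]
    have : ∑ x, N.q s k x * conj (N.q s k x) = 1 := by
      rw [← hq]
      exact Finset.sum_congr rfl fun x _ => mul_comm _ _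
    rw [this, map_inv₀, Complex.conj_ofReal, mul_one, ← mul_inv, hP]
    simp
  · have hi' : ¬ i' = i := fun h => hi h.symm
    simp [hi, hi']

/-- The correlator output contains each channel of its group once; only the same user's channel
contributes, damped by `ρ^d`. -/
theorem covar_gCoef_yCoef {t d : ℕ} (hd : d ≤ t) (l : Fin C) (k k' : Fin NG) (c : Fin C)
    (i i' : Fin M) :
    covar N.sourceVariance (N.gCoef l k c i t) (N.yCoef l k' i' (t - d))
      = if k = k' ∧ i = i' then ((N.ρ l k c ^ d * N.β l k c : ℝ) : ℂ) else 0 := by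
  rw [yCoef, covar_add_right, covar_sum_right, covar_gCoef_nCoef, add_zero]
  simp_rw [N.covar_gCoef hd]
  by_cases hh : k = k' ∧ i = i'
  · simp [hh.1, hh.2]
  · rw [if_neg hh]
    refine Finset.sum_eq_zero fun b _ => if_neg fun h => hh ⟨h.1, h.2.2⟩

theorem covar_yCoef (l : Fin C) {k : Fin NG} (i i' : Fin M) {s : ℕ} (hk : k ∈ N.trained s) :
    covar N.sourceVariance (N.yCoef l k i s) (N.yCoef l k i' s)
      = if i = i' then (N.yVar l k : ℂ) else 0 := by
  have h1 : ∀ b, covar N.sourceVariance (N.gCoef l k b i s) (N.yCoef l k i' s)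
      = if i = i' then (N.β l k b : ℂ) else 0 := fun b => by
    simpa using N.covar_gCoef_yCoef (Nat.zero_le s) l k k b i i'
  have h2 : ∀ b, covar N.sourceVariance (N.nCoef l k i s) (N.gCoef l k b i' s) = 0 := fun b =>
    covar_eq_zero_symm _ (N.covar_gCoef_nCoef l k k b i' i s s)
  have h3 : covar N.sourceVariance (N.nCoef l k i s) (N.yCoef l k i' s)
      = if i = i' then ((1 / N.Pp : ℝ) : ℂ) else 0 := by
    rw [yCoef, covar_add_right, covar_sum_right, N.covar_nCoef l i i' hk]
    simp [h2]
  nth_rewrite 1 [yCoef]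
  rw [covar_add_left, covar_sum_left, h3]
  simp_rw [h1]
  split_ifs
  · rw [yVar, Complex.ofReal_add, Complex.ofReal_sum, add_comm]
  · simp

variable {N} {t : ℕ} {d : Fin NG → ℕ}

/-- The orthogonality principle: the factor `ρ^d β / D` in `vCoef` is the covariance of channel and
correlator output over the variance of the latter. Other groups share no source with this output. -/
theorem covar_yCoef_vCoef (hd : N.IsCSIDelay t d) (l : Fin C) (k : Fin NG) (kc : Fin NG × Fin C)
    (i i' : Fin M) :
    covar N.sourceVariance (N.yCoef l k i (t - d k)) (N.vCoef t d l k kc i') = 0 := by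
  apply covar_eq_zero_symm
  rw [vCoef]
  split_ifs with hk
  · rw [covar_sub_left, covar_smul_left, N.covar_gCoef_yCoef (hd k).1,
      N.covar_yCoef l i' i (hd k).2.1]
    have := (N.yVar_pos l k).ne'
    by_cases hi : i' = i
    · have e : (N.ρ l k kc.2 ^ d k * (N.β l k kc.2 / N.yVar l k) : ℝ) * N.yVar l k
          = N.ρ l k kc.2 ^ d k * N.β l k kc.2 := by field_simp
      rw [if_pos ⟨rfl, hi⟩, if_pos hi, ← Complex.ofReal_mul, e, sub_self]
    · simp [hi]
  · rw [N.covar_gCoef_yCoef (hd k).1, if_neg fun h => hk h.1]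

/-- Since the residual is orthogonal to the correlator output, its variance equals its covariance
with the channel itself. -/
theorem covar_vCoef (hd : N.IsCSIDelay t d) (l : Fin C) (k : Fin NG) (kc : Fin NG × Fin C)
    (i i' : Fin M) :
    covar N.sourceVariance (N.vCoef t d l k kc i) (N.vCoef t d l k kc i')
      = if i = i' then (N.vVar d l k kc : ℂ) else 0 := by
  by_cases hk : kc.1 = k
  · have h1 := covar_eq_zero_symm _ (covar_yCoef_vCoef hd l k kc i' i)
    have h2 : N.vCoef t d l k kc i' = N.gCoef l k kc.2 i' t
      - ((N.ρ l k kc.2 ^ d k * (N.β l k kc.2 / N.yVar l k) : ℝ) : ℂ) • N.yCoef l k i' (t - d k) := by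
      rw [vCoef, if_pos hk]
    rw [h2, covar_sub_right, covar_smul_right, h1, mul_zero, sub_zero, vCoef, if_pos hk,
      covar_sub_left, covar_smul_left, covar_gCoef_self, ← covar_conj _ (N.gCoef l k kc.2 i' t),
      N.covar_gCoef_yCoef (hd k).1, vVar, if_pos hk]
    by_cases hi : i = i'
    · simp only [hi, and_self, if_true, Complex.conj_ofReal]
      rw [← Complex.ofReal_mul, ← Complex.ofReal_sub]
      congr 1
      rw [mul_comm 2, pow_mul]
      ring
    · simp [hi, Ne.symm hi]
  · rw [vCoef, vCoef, if_neg hk, if_neg hk, covar_gCoef_self, vVar, if_neg hk]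
    simp

theorem covar_yCoef_dataNoise (l : Fin C) (k : Fin NG) (i i' : Fin M) (s : ℕ) :
    covar N.sourceVariance (N.yCoef l k i s) (Finsupp.single (.dataNoise l i') 1) = 0 := by
  rw [covar_single_right]
  simp [yCoef, gCoef, nCoef, hCoef_dataNoise]

theorem covar_vCoef_dataNoise (l : Fin C) (k : Fin NG) (kc : Fin NG × Fin C) (i i' : Fin M) :
    covar N.sourceVariance (N.vCoef t d l k kc i) (Finsupp.single (.dataNoise l i') 1) = 0 := by
  rw [vCoef]
  split_ifs
  · rw [covar_sub_left, covar_smul_left, covar_yCoef_dataNoise, covar_single_right]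
    simp [gCoef, hCoef_dataNoise]
  · rw [covar_single_right]
    simp [gCoef, hCoef_dataNoise]

theorem covar_dataNoise (l : Fin C) (i i' : Fin M) :
    covar N.sourceVariance (Finsupp.single (.dataNoise l i) 1) (Finsupp.single (.dataNoise l i') 1)
      = if i = i' then 1 else 0 := by
  classical
  rw [covar_single_right, Finsupp.single_apply]
  simp [sourceVariance]

end Network

/-! ### Identification of the model with linear combinations of the sources. -/

namespace Model

variable {N : Network C NG M τ} {Ω : Type*} [MeasurableSpace Ω] {μ : Measure Ω} (X : Model N μ)

theorem isGaussianSources : IsGaussianSources X.Z N.sourceVariance μ where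
  nonneg x := by
    cases x with
    | innovation l k c s i =>
      have := (sq_le_one_iff_abs_le_one _).2 (N.abs_ρ_le_one l k c)
      simp only [Network.sourceVariance]
      linarith
    | _ => simp [Network.sourceVariance]
  meas := X.measurable_Z
  law := X.law_Z
  indep := X.indep_Z

theorem h_apply (l : Fin C) (k : Fin NG) (c : Fin C) (i : Fin M) (s : ℕ) (ω : Ω) :
    X.h l k c s ω i = lin X.Z (N.hCoef l k c i s) ω := by
  induction s with
  | zero => rw [Network.hCoef, lin_single]; rfl
  | succ s ih => rw [Network.hCoef, lin_add, lin_smul, lin_single, ← ih]; rfl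

theorem g_apply (l : Fin C) (k : Fin NG) (c : Fin C) (i : Fin M) (s : ℕ) (ω : Ω) :
    X.g l k c s ω i = lin X.Z (N.gCoef l k c i s) ω := by
  rw [Network.gCoef, lin_smul, ← h_apply]; rfl

/-- The scaled correlator output `Yp q / √Pp`. -/
def y (l : Fin C) (k : Fin NG) (s : ℕ) (ω : Ω) : EuclideanSpace ℂ (Fin M) :=
  WithLp.toLp 2 fun i => lin X.Z (N.yCoef l k i s) ω

/-- The part of the channel of user `kc` that is unknown to the BS when it detects group `k`. -/
def v (t : ℕ) (d : Fin NG → ℕ) (l : Fin C) (k : Fin NG) (kc : Fin NG × Fin C) (ω : Ω) :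
    EuclideanSpace ℂ (Fin M) :=
  WithLp.toLp 2 fun i => lin X.Z (N.vCoef t d l k kc i) ω

/-- Orthonormal pilots remove the other trained groups. What remains is the same vector `y` for
every cell `c`, which is pilot contamination. -/
theorem gHat_eq (l : Fin C) {k : Fin NG} (c : Fin C) {s : ℕ} (hk : k ∈ N.trained s) (ω : Ω) :
    X.gHat l k c s ω = ((N.β l k c / N.yVar l k : ℝ) : ℂ) • X.y l k s ω := by
  rw [gHat, ← Network.yVar]
  congr 1
  ext i
  have hP : (√N.Pp : ℂ) ≠ 0 := by exact_mod_cast (Real.sqrt_pos.2 N.Pp_pos).ne'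
  simp only [PiLp.smul_apply, smul_eq_mul, y, Network.yCoef, lin_add, lin_sum, Matrix.mulVec,
    dotProduct, Yp, Matrix.of_apply, add_mul, Finset.sum_add_distrib, mul_add]
  congr 1
  · simp_rw [Finset.sum_mul, ← g_apply]
    rw [Finset.sum_comm, Finset.mul_sum]
    refine Finset.sum_congr rfl fun b _ => ?_
    rw [Finset.sum_comm]
    have : ∀ k' ∈ N.trained s, ∑ j, (√N.Pp : ℂ) * X.g l k' b s ω i * conj (N.q s k' j) * N.q s k j
        = (√N.Pp : ℂ) * X.g l k' b s ω i * if k' = k then 1 else 0 := fun k' hk' => by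
      rw [← N.q_orthonormal s k' hk' k hk, Finset.mul_sum]
      simp_rw [mul_assoc]
    rw [Finset.sum_congr rfl this]
    simp [hk, inv_mul_cancel_left₀ hP]
  · rw [Network.nCoef, lin_smul, lin_sum]
    simp_rw [lin_smul, lin_single, mul_comm]

/-- For the group itself, damped estimation error plus innovations equals `g(t) - ρ^d ĝ(t - d)`, by
unrolling the recursion. This is the residual `v`. -/
theorem I₃_eq {t : ℕ} {d : Fin NG → ℕ} (hd : N.IsCSIDelay t d) (l : Fin C) (k : Fin NG) (ω : Ω)
    (σ : Fin NG → Fin C → ℂ) (w : EuclideanSpace ℂ (Fin M)) :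
    X.I₃ t d l k ω σ w
      = ∑ kc : Fin NG × Fin C, σ kc.1 kc.2 • X.v t d l k kc ω + (√N.Pu : ℂ)⁻¹ • w := by
  have hv1 : ∀ c, X.v t d l k (k, c) ω
      = X.g l k c t ω - (N.ρ l k c : ℂ) ^ d k • X.gHat l k c (t - d k) ω := by
    intro c
    rw [X.gHat_eq l c (hd k).2.1]
    ext i
    simp only [v, Network.vCoef, if_true, lin_sub, lin_smul, y, PiLp.sub_apply, PiLp.smul_apply,
      smul_eq_mul, g_apply]
    push_cast
    ring
  have hv2 : ∀ k' c, k' ≠ k → X.v t d l k (k', c) ω = X.g l k' c t ω := by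
    intro k' c hk'
    ext i
    simp only [v, Network.vCoef, if_neg hk', g_apply]
  rw [I₃, Fintype.sum_prod_type, ← Finset.add_sum_erase _ _ (Finset.mem_univ k),
    ← Finset.sum_add_distrib]
  congr 2
  · refine Finset.sum_congr rfl fun c _ => ?_
    rw [hv1, X.g_unroll l k c ω t (d k) (hd k).1, gTilde]
    simp only [smul_sub, smul_add, smul_smul, Finset.smul_sum, mul_comm (σ k c)]
    abel
  · refine Finset.sum_congr rfl fun k' hk' => Finset.sum_congr rfl fun c _ => ?_
    rw [hv2 k' c (Finset.ne_of_mem_erase hk')]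

end Model

end

/-! ### Averages over symbols, residual channels and noise. -/

section
variable {C NG M τ : ℕ}

namespace Model

variable {N : Network C NG M τ} {Ω : Type*} [MeasurableSpace Ω] {μ : Measure Ω} (X : Model N μ)

theorem measurable_y (l : Fin C) (k : Fin NG) (s : ℕ) : Measurable (X.y l k s) := by
  refine (WithLp.measurable_toLp 2 _).comp (measurable_pi_lambda _ fun i => ?_)
  exact X.isGaussianSources.measurable_lin _

theorem measurable_v (t : ℕ) (d : Fin NG → ℕ) (l : Fin C) (k : Fin NG) (kc : Fin NG × Fin C) :
    Measurable (X.v t d l k kc) := by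
  refine (WithLp.measurable_toLp 2 _).comp (measurable_pi_lambda _ fun i => ?_)
  exact X.isGaussianSources.measurable_lin _

theorem measurable_Wu (l : Fin C) : Measurable (X.Wu l) := by
  refine (WithLp.measurable_toLp 2 _).comp (measurable_pi_lambda _ fun i => ?_)
  exact X.measurable_Z _

theorem memLp_S (k : Fin NG) (c : Fin C) : MemLp (X.S k c) 2 μ := by
  rw [memLp_two_iff_integrable_sq_norm (X.measurable_S k c).aestronglyMeasurable]
  have h1 : Integrable (fun ω => X.S k c ω * conj (X.S k c ω)) μ := by
    -- A non-integrable energy would have integral `0` by convention, contradicting unit energy.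
    by_contra h
    have := X.symbol_corr k c k c
    rw [integral_undef h] at this
    simp at this
  refine h1.norm.congr (.of_forall fun ω => ?_)
  simp [pow_two]

theorem integral_norm_sq_S (k : Fin NG) (c : Fin C) : ∫ ω, ‖X.S k c ω‖ ^ 2 ∂μ = 1 := by
  rw [← Complex.ofReal_inj, ofReal_integral_norm_sq, X.symbol_corr]
  simp

theorem Wu_eq (l : Fin C) : X.Wu l = fun ω =>
    WithLp.toLp 2 fun i => lin X.Z (Finsupp.single (.dataNoise l i) 1) ω := by
  simp only [lin_single]
  rfl

/-- Coefficients of the inner product of `x` with a vector whose entries have coefficients `a`. -/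
def innerCoef {ι : Type*} (x : EuclideanSpace ℂ (Fin M)) (a : Fin M → ι →₀ ℂ) : ι →₀ ℂ :=
  ∑ i, conj (x i) • a i

omit [MeasurableSpace Ω] in
theorem inner_toLp_lin {ι : Type*} (Z : ι → Ω → ℂ) (x : EuclideanSpace ℂ (Fin M))
    (a : Fin M → ι →₀ ℂ) (ω : Ω) :
    inner ℂ x (WithLp.toLp 2 fun i => lin Z (a i) ω) = lin Z (innerCoef x a) ω := by
  rw [innerCoef, lin_sum, PiLp.inner_apply]
  refine Finset.sum_congr rfl fun i _ => ?_
  rw [lin_smul, RCLike.inner_apply, mul_comm]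

/-- A white vector has the same variance `r` in every unit direction. -/
theorem covar_innerCoef {ι : Type*} (v : ι → ℝ) (x : EuclideanSpace ℂ (Fin M))
    {a b : Fin M → ι →₀ ℂ} {r : ℝ}
    (h : ∀ i j, covar v (a i) (b j) = if i = j then (r : ℂ) else 0) :
    covar v (innerCoef x a) (innerCoef x b) = (‖x‖ ^ 2 * r : ℝ) := by
  rw [innerCoef, innerCoef, covar_sum_left]
  simp_rw [covar_sum_right, covar_smul_left, covar_smul_right, h, mul_ite, mul_zero]
  simp only [Finset.sum_ite_eq, Finset.mem_univ, if_true, Complex.conj_conj]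
  rw [EuclideanSpace.norm_sq_eq, Finset.sum_mul, Complex.ofReal_sum]
  refine Finset.sum_congr rfl fun i _ => ?_
  rw [← mul_assoc, mul_comm (conj _), Complex.mul_conj, Complex.normSq_eq_norm_sq,
    ← Complex.ofReal_mul]

theorem inner_v (t : ℕ) (d : Fin NG → ℕ) (l : Fin C) (k : Fin NG) (kc : Fin NG × Fin C)
    (x : EuclideanSpace ℂ (Fin M)) (ω : Ω) :
    inner ℂ x (X.v t d l k kc ω) = lin X.Z (innerCoef x (N.vCoef t d l k kc)) ω :=
  inner_toLp_lin _ _ _ _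

theorem inner_Wu (l : Fin C) (x : EuclideanSpace ℂ (Fin M)) (ω : Ω) :
    inner ℂ x (X.Wu l ω)
      = lin X.Z (innerCoef x fun i => Finsupp.single (.dataNoise l i) 1) ω := by
  rw [← inner_toLp_lin, Wu_eq]

theorem inner_I₃_arg (x : EuclideanSpace ℂ (Fin M)) (σ : Fin NG → Fin C → ℂ)
    (vv : Fin NG × Fin C → EuclideanSpace ℂ (Fin M)) (w : EuclideanSpace ℂ (Fin M)) :
    inner ℂ x (∑ kc, σ kc.1 kc.2 • vv kc + (√N.Pu : ℂ)⁻¹ • w)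
      = ∑ kc, σ kc.1 kc.2 * inner ℂ x (vv kc) + (√N.Pu : ℂ)⁻¹ * inner ℂ x w := by
  rw [inner_add_right, inner_sum, inner_smul_right]
  simp_rw [inner_smul_right]

theorem symbols_corr (kc kc' : Fin NG × Fin C) :
    ∫ ω, X.S kc.1 kc.2 ω * conj (X.S kc'.1 kc'.2 ω) ∂μ = if kc = kc' then 1 else 0 := by
  rw [X.symbol_corr]
  simp only [Prod.ext_iff]

theorem memLp_noise (l : Fin C) (x : EuclideanSpace ℂ (Fin M)) :
    MemLp (fun ω => (√N.Pu : ℂ)⁻¹ * inner ℂ x (X.Wu l ω)) 2 μ := by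
  simp_rw [inner_Wu]
  exact (X.isGaussianSources.memLp_lin _).const_mul _

theorem integral_norm_sq_noise (l : Fin C) (x : EuclideanSpace ℂ (Fin M)) :
    ∫ ω, ‖(√N.Pu : ℂ)⁻¹ * inner ℂ x (X.Wu l ω)‖ ^ 2 ∂μ = ‖x‖ ^ 2 * (1 / N.Pu) := by
  have h1 := covar_innerCoef N.sourceVariance x (r := 1) fun i j => by
    simpa using Network.covar_dataNoise (N := N) l i j
  simp_rw [inner_Wu, norm_mul, mul_pow]
  rw [integral_const_mul, X.isGaussianSources.integral_norm_sq_lin _ h1, mul_one, norm_inv,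
    Complex.norm_real, Real.norm_eq_abs, inv_pow, sq_abs, Real.sq_sqrt N.Pu_pos.le]
  ring

theorem indepFun_symbols_lin {J : Type*} (a : J → Source C NG M τ →₀ ℂ) :
    IndepFun (fun ω (kc : Fin NG × Fin C) => X.S kc.1 kc.2 ω) (fun ω j => lin X.Z (a j) ω) μ := by
  refine X.indep_S_Z.comp (φ := id) (ψ := fun z j => ∑ x ∈ (a j).support, a j x * z x)
    measurable_id ?_
  fun_prop

/-- Averaging the symbols and the data noise, for fixed channels. -/
theorem integral_norm_sq_inner_symbols_noise [IsProbabilityMeasure μ] (l : Fin C)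
    (x : EuclideanSpace ℂ (Fin M)) (vv : Fin NG × Fin C → EuclideanSpace ℂ (Fin M)) :
    ∫ ω, ‖inner ℂ x (∑ kc : Fin NG × Fin C, X.S kc.1 kc.2 ω • vv kc
        + (√N.Pu : ℂ)⁻¹ • X.Wu l ω)‖ ^ 2 ∂μ
      = ∑ kc, ‖inner ℂ x (vv kc)‖ ^ 2 + ‖x‖ ^ 2 * (1 / N.Pu) := by
  have h1 := (memLp_and_integral_norm_sq_sum_mul_add (μ := μ)
    (S := fun kc : Fin NG × Fin C => X.S kc.1 kc.2) (v := fun kc _ => inner ℂ x (vv kc))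
    (w := fun ω => (√N.Pu : ℂ)⁻¹ * inner ℂ x (X.Wu l ω)) (fun kc => X.memLp_S _ _)
    (fun kc => memLp_const _) (X.memLp_noise l x) ?_ X.symbols_corr ?_).2
  · rw [X.integral_norm_sq_noise] at h1
    simp only [integral_const, probReal_univ, one_smul] at h1
    rw [← h1]
    congr with ω
    exact congrArg (fun z : ℂ => ‖z‖ ^ 2) (inner_I₃_arg (N := N) x (X.symbols ω) _ _)
  · simp_rw [inner_Wu]
    exact (X.indepFun_symbols_lin fun _ : Unit =>
      innerCoef x fun i => Finsupp.single (.dataNoise l i) 1).comp (φ := id)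
      (ψ := fun f : Unit → ℂ => ((fun kc => inner ℂ x (vv kc)), (√N.Pu : ℂ)⁻¹ * f ()))
      measurable_id (by fun_prop)
  · intro kc
    rw [integral_const_mul, integral_conj, integral_const_mul]
    simp_rw [inner_Wu]
    rw [X.isGaussianSources.integral_lin]
    simp

theorem covar_innerCoef_vCoef_dataNoise (t : ℕ) (d : Fin NG → ℕ) (l : Fin C) (k : Fin NG)
    (kc : Fin NG × Fin C) (x : EuclideanSpace ℂ (Fin M)) :
    covar N.sourceVariance (innerCoef x (N.vCoef t d l k kc))
      (innerCoef x fun i => Finsupp.single (.dataNoise l i) 1) = 0 := by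
  have := covar_innerCoef N.sourceVariance x (r := 0) (a := N.vCoef t d l k kc)
    (b := fun i => Finsupp.single (.dataNoise l i) 1) fun i j => by
      simp [Network.covar_vCoef_dataNoise]
  simpa using this

/-- Averaging the symbols, the unknown parts of the channels, and the data noise. -/
theorem memLp_and_integral_norm_sq_inner [IsProbabilityMeasure μ] {t : ℕ} {d : Fin NG → ℕ}
    (hd : N.IsCSIDelay t d) (l : Fin C) (k : Fin NG) (x : EuclideanSpace ℂ (Fin M)) :
    MemLp (fun ω => inner ℂ x (∑ kc : Fin NG × Fin C, X.S kc.1 kc.2 ω • X.v t d l k kc ω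
        + (√N.Pu : ℂ)⁻¹ • X.Wu l ω)) 2 μ ∧
    ∫ ω, ‖inner ℂ x (∑ kc : Fin NG × Fin C, X.S kc.1 kc.2 ω • X.v t d l k kc ω
        + (√N.Pu : ℂ)⁻¹ • X.Wu l ω)‖ ^ 2 ∂μ
      = ‖x‖ ^ 2 * (∑ kc, N.vVar d l k kc + 1 / N.Pu) := by
  have hG := X.isGaussianSources
  have h1 := memLp_and_integral_norm_sq_sum_mul_add (μ := μ)
    (S := fun kc : Fin NG × Fin C => X.S kc.1 kc.2)
    (v := fun kc ω => inner ℂ x (X.v t d l k kc ω))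
    (w := fun ω => (√N.Pu : ℂ)⁻¹ * inner ℂ x (X.Wu l ω)) (fun kc => X.memLp_S _ _)
    (fun kc => by simp_rw [inner_v]; exact hG.memLp_lin _)
    (X.memLp_noise l x) ?_ X.symbols_corr ?_
  · have e : ∀ ω, inner ℂ x (∑ kc : Fin NG × Fin C, X.S kc.1 kc.2 ω • X.v t d l k kc ω
        + (√N.Pu : ℂ)⁻¹ • X.Wu l ω)
        = ∑ kc : Fin NG × Fin C, X.S kc.1 kc.2 ω * inner ℂ x (X.v t d l k kc ω)
          + (√N.Pu : ℂ)⁻¹ * inner ℂ x (X.Wu l ω) := fun ω =>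
      inner_I₃_arg x (X.symbols ω) _ _
    simp_rw [e]
    refine ⟨h1.1, h1.2.trans ?_⟩
    rw [X.integral_norm_sq_noise, mul_add, Finset.mul_sum]
    congr 1
    refine Finset.sum_congr rfl fun kc _ => ?_
    simp_rw [inner_v]
    exact hG.integral_norm_sq_lin _ (covar_innerCoef _ x (Network.covar_vCoef hd l k kc))
  · simp_rw [inner_Wu, inner_v]
    exact (X.indepFun_symbols_lin fun o : Option (Fin NG × Fin C) => o.elim
      (innerCoef x fun i => Finsupp.single (.dataNoise l i) 1)
      fun kc => innerCoef x (N.vCoef t d l k kc)).comp (φ := id)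
      (ψ := fun f => ((fun kc => f (some kc)), (√N.Pu : ℂ)⁻¹ * f none))
      measurable_id (by fun_prop)
  · intro kc
    simp_rw [inner_Wu, inner_v, map_mul,
      mul_left_comm (lin X.Z (innerCoef x (N.vCoef t d l k kc)) _)]
    rw [integral_const_mul, hG.integral_lin_mul_conj, covar_innerCoef_vCoef_dataNoise, mul_zero]

/-- The correlator output is independent of the unknown channel parts and the data noise. -/
theorem indepFun_y {t : ℕ} {d : Fin NG → ℕ} (hd : N.IsCSIDelay t d) (l : Fin C) (k : Fin NG) :
    IndepFun (X.y l k (t - d k)) (fun ω => ((fun kc => X.v t d l k kc ω), X.Wu l ω)) μ := by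
  have h1 := X.isGaussianSources.indepFun_lin
    (a := fun i => N.yCoef l k i (t - d k))
    (b := fun j : (Fin NG × Fin C) × Fin M ⊕ Fin M =>
      Sum.elim (fun p => N.vCoef t d l k p.1 p.2) (fun i => Finsupp.single (.dataNoise l i) 1) j) ?_
  · have h2 := h1.comp (φ := WithLp.toLp 2)
      (ψ := fun f : ((Fin NG × Fin C) × Fin M ⊕ Fin M) → ℂ =>
        ((fun kc => WithLp.toLp 2 fun i => f (.inl (kc, i)) :
          Fin NG × Fin C → EuclideanSpace ℂ (Fin M)),
          (WithLp.toLp 2 fun i => f (.inr i) : EuclideanSpace ℂ (Fin M))))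
      (WithLp.measurable_toLp 2 _) (by fun_prop)
    rw [Wu_eq]
    exact h2
  · rintro i (p | j)
    · exact Network.covar_yCoef_vCoef hd l k p.1 i p.2
    · exact Network.covar_yCoef_dataNoise l k i j _

/-- The symbols are independent of all Gaussian variables jointly, and `y` of the remaining ones;
the two facts combine. -/
theorem indepFun_y_symbols [IsProbabilityMeasure μ] {t : ℕ} {d : Fin NG → ℕ}
    (hd : N.IsCSIDelay t d) (l : Fin C) (k : Fin NG) :
    IndepFun (X.y l k (t - d k)) (fun ω => ((fun kc : Fin NG × Fin C => X.S kc.1 kc.2 ω),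
      (fun kc => X.v t d l k kc ω), X.Wu l ω)) μ := by
  refine indepFun_prodMk_of_indepFun
    (measurable_pi_lambda _ fun kc => X.measurable_S _ _) (X.measurable_y _ _ _)
    ((measurable_pi_lambda _ fun kc => X.measurable_v _ _ _ _ _).prodMk (X.measurable_Wu l)) ?_
    (X.indepFun_y hd l k)
  have h1 := X.indepFun_symbols_lin fun j : Fin M ⊕ (Fin NG × Fin C) × Fin M ⊕ Fin M =>
    Sum.elim (fun i => N.yCoef l k i (t - d k))
      (Sum.elim (fun p => N.vCoef t d l k p.1 p.2)
        (fun i => Finsupp.single (.dataNoise l i) 1)) j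
  have h2 := h1.comp (φ := id)
      (ψ := fun f : (Fin M ⊕ (Fin NG × Fin C) × Fin M ⊕ Fin M) → ℂ =>
        ((WithLp.toLp 2 fun i => f (.inl i) : EuclideanSpace ℂ (Fin M)),
          (fun kc => WithLp.toLp 2 fun i => f (.inr (.inl (kc, i))) :
          Fin NG × Fin C → EuclideanSpace ℂ (Fin M)),
          (WithLp.toLp 2 fun i => f (.inr (.inr i)) : EuclideanSpace ℂ (Fin M))))
      measurable_id (by fun_prop)
  rw [Wu_eq]
  exact h2

/-- The noise along `x` has no atoms and is independent of all the other terms. This keeps the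
instantaneous denominator positive, as Jensen's inequality requires. -/
theorem ae_inner_ne_zero [IsProbabilityMeasure μ] (t : ℕ) (d : Fin NG → ℕ) (l : Fin C)
    (k : Fin NG) {x : EuclideanSpace ℂ (Fin M)} (hx : x ≠ 0) :
    ∀ᵐ ω ∂μ, (inner ℂ x (∑ kc : Fin NG × Fin C, X.S kc.1 kc.2 ω • X.v t d l k kc ω
        + (√N.Pu : ℂ)⁻¹ • X.Wu l ω) : ℂ) ≠ 0 := by
  have hG := X.isGaussianSources
  obtain ⟨a, ha⟩ : ∃ a : Source C NG M τ →₀ ℂ,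
    a = (√N.Pu : ℂ)⁻¹ • innerCoef x fun i => Finsupp.single (.dataNoise l i) 1 := ⟨_, rfl⟩
  obtain ⟨b, hb⟩ : ∃ b : Fin NG × Fin C → Source C NG M τ →₀ ℂ,
    ∀ kc, b kc = innerCoef x (N.vCoef t d l k kc) := ⟨_, fun _ => rfl⟩
  have e : ∀ ω, (inner ℂ x (∑ kc : Fin NG × Fin C, X.S kc.1 kc.2 ω • X.v t d l k kc ω
        + (√N.Pu : ℂ)⁻¹ • X.Wu l ω) : ℂ)
      = lin X.Z a ω + ∑ kc : Fin NG × Fin C, X.S kc.1 kc.2 ω * lin X.Z (b kc) ω := by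
    intro ω
    refine (inner_I₃_arg (N := N) x (X.symbols ω) (fun kc => X.v t d l k kc ω) _).trans ?_
    rw [ha, lin_smul, inner_Wu, add_comm]
    congr 1
    refine Finset.sum_congr rfl fun kc _ => ?_
    rw [hb, inner_v]
    rfl
  simp_rw [e]
  have hSm : Measurable fun ω (kc : Fin NG × Fin C) => X.S kc.1 kc.2 ω :=
    measurable_pi_lambda _ fun kc => X.measurable_S _ _
  have hbm : Measurable fun ω kc => lin X.Z (b kc) ω :=
    measurable_pi_lambda _ fun kc => hG.measurable_lin _
  have h1 : IndepFun (lin X.Z a) (fun ω kc => lin X.Z (b kc) ω) μ := by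
    refine (hG.indepFun_lin (a := fun _ : Unit => a) (b := b) fun _ kc => ?_).comp
      (φ := fun f : Unit → ℂ => f ()) (ψ := id) (by fun_prop) measurable_id
    rw [ha, hb, covar_smul_left, covar_eq_zero_symm _ (covar_innerCoef_vCoef_dataNoise t d l k kc x),
      mul_zero]
  have h0 : IndepFun (fun ω (kc : Fin NG × Fin C) => X.S kc.1 kc.2 ω)
      (fun ω => (lin X.Z a ω, fun kc => lin X.Z (b kc) ω)) μ :=
    (X.indepFun_symbols_lin fun o : Option (Fin NG × Fin C) => o.elim a b).comp (φ := id)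
      (ψ := fun f : Option (Fin NG × Fin C) → ℂ => (f none, fun kc => f (some kc)))
      measurable_id (by fun_prop)
  have h2 := indepFun_prodMk_of_indepFun hSm (hG.measurable_lin a) hbm h0 h1
  have hnoise : covar N.sourceVariance a a = (‖x‖ ^ 2 * (1 / N.Pu) : ℝ) := by
    have h3 := covar_innerCoef N.sourceVariance x (r := 1) fun i j => by
      simpa using Network.covar_dataNoise (N := N) l i j
    rw [ha, covar_smul_left, covar_smul_right, h3, ← mul_assoc, map_inv₀, Complex.conj_ofReal,
      ← mul_inv, Network.sqrt_mul_sqrt_ofReal N.Pu_pos.le]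
    push_cast
    ring
  have hpos : 0 < ‖x‖ ^ 2 * (1 / N.Pu) :=
    mul_pos (pow_pos (norm_pos_iff.2 hx) 2) (one_div_pos.2 N.Pu_pos)
  refine ae_add_ne_zero_of_indepFun (hG.measurable_lin a) ?_
    (h2.comp (φ := id) (ψ := fun p : (Fin NG × Fin C → ℂ) × (Fin NG × Fin C → ℂ) =>
      ∑ kc, p.1 kc * p.2 kc) measurable_id (by fun_prop))
    (hG.measure_lin_preimage_singleton a hnoise hpos)
  exact (show Measurable fun p : (Fin NG × Fin C → ℂ) × (Fin NG × Fin C → ℂ) =>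
    ∑ kc, p.1 kc * p.2 kc by fun_prop).comp (hSm.prodMk hbm)

theorem ae_y_ne_zero (hM : 1 ≤ M) (l : Fin C) {k : Fin NG} {s : ℕ} (hk : k ∈ N.trained s) :
    ∀ᵐ ω ∂μ, X.y l k s ω ≠ 0 := by
  have h1 := X.isGaussianSources.measure_lin_preimage_singleton (N.yCoef l k ⟨0, hM⟩ s)
    (r := N.yVar l k) (by rw [N.covar_yCoef l _ _ hk, if_pos rfl]) (N.yVar_pos l k) 0
  rw [ae_iff]
  refine measure_mono_null (fun ω hω => ?_) h1
  have h2 : X.y l k s ω = 0 := not_not.1 hω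
  exact congrArg (fun z : EuclideanSpace ℂ (Fin M) => z ⟨0, hM⟩) h2

theorem lintegral_one_div_norm_sq_y_le (hM : 2 ≤ M) (l : Fin C) {k : Fin NG} {s : ℕ}
    (hk : k ∈ N.trained s) :
    ∫⁻ ω, ENNReal.ofReal (1 / ‖X.y l k s ω‖ ^ 2) ∂μ
      ≤ ENNReal.ofReal (1 / (N.yVar l k * (M - 1))) := by
  have := X.isGaussianSources.lintegral_one_div_sum_norm_sq_le hM (N.yVar_pos l k)
    fun i j => N.covar_yCoef l i j hk
  simpa only [y, EuclideanSpace.norm_sq_eq] using this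

/-- A quantity that depends on the correlator output and on variables independent of it, divided by
the energy of the correlator output. -/
theorem lintegral_div_norm_sq_y_le [IsProbabilityMeasure μ] (hM : 2 ≤ M) (l : Fin C) {k : Fin NG}
    {s : ℕ} (hk : k ∈ N.trained s) {F : Type*} [MeasurableSpace F] {V : Ω → F} (hV : Measurable V)
    (hind : IndepFun (X.y l k s) V μ) {Q : EuclideanSpace ℂ (Fin M) → F → ℝ}
    (hQ : Measurable (Function.uncurry Q)) (hQ0 : ∀ x f, 0 ≤ Q x f) {K : ℝ} (hK : 0 ≤ K)
    (hQK : ∀ x, ∫⁻ ω, ENNReal.ofReal (Q x (V ω)) ∂μ ≤ ENNReal.ofReal K) :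
    ∫⁻ ω, ENNReal.ofReal (Q (X.y l k s ω) (V ω) / ‖X.y l k s ω‖ ^ 2) ∂μ
      ≤ ENNReal.ofReal (K * (1 / (N.yVar l k * (M - 1)))) := by
  rw [lintegral_of_indepFun (X.measurable_y l k s) hV hind
    (f := fun x f => ENNReal.ofReal (Q x f / ‖x‖ ^ 2))
    (by exact (hQ.div (by fun_prop)).ennreal_ofReal), ENNReal.ofReal_mul hK]
  calc ∫⁻ ω, ∫⁻ ω', ENNReal.ofReal (Q (X.y l k s ω) (V ω') / ‖X.y l k s ω‖ ^ 2) ∂μ ∂μ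
      ≤ ∫⁻ ω, ENNReal.ofReal K * ENNReal.ofReal (1 / ‖X.y l k s ω‖ ^ 2) ∂μ := by
        refine lintegral_mono fun ω => ?_
        simp_rw [div_eq_mul_one_div (Q _ _), ENNReal.ofReal_mul (hQ0 _ _)]
        rw [lintegral_mul_const' _ _ ENNReal.ofReal_ne_top]
        gcongr
        exact hQK _
    _ = ENNReal.ofReal K * ∫⁻ ω, ENNReal.ofReal (1 / ‖X.y l k s ω‖ ^ 2) ∂μ :=
        lintegral_const_mul' _ _ ENNReal.ofReal_ne_top
    _ ≤ _ := by
        gcongr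
        exact X.lintegral_one_div_norm_sq_y_le hM l hk

end Model

end

/-! ### The SINR as a ratio, and the bound for each user. -/

section
variable {C NG M τ : ℕ}

/-- The vector `x` scaled to unit norm. -/
def unitVec (x : EuclideanSpace ℂ (Fin M)) : EuclideanSpace ℂ (Fin M) := (‖x‖ : ℂ)⁻¹ • x

theorem norm_unitVec {x : EuclideanSpace ℂ (Fin M)} (hx : x ≠ 0) : ‖unitVec x‖ = 1 := by
  rw [unitVec, norm_smul, norm_inv, Complex.norm_real, norm_norm,
    inv_mul_cancel₀ (norm_ne_zero_iff.2 hx)]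

/-- An inequality because `unitVec 0 = 0`; it spares a null set when bounding the mean for every
frozen `x`. -/
theorem norm_sq_unitVec_le (x : EuclideanSpace ℂ (Fin M)) : ‖unitVec x‖ ^ 2 ≤ 1 := by
  by_cases hx : x = 0
  · simp [hx, unitVec]
  · rw [norm_unitVec hx, one_pow]

theorem measurable_unitVec : Measurable (unitVec : EuclideanSpace ℂ (Fin M) → _) := by
  unfold unitVec
  fun_prop

theorem unitVec_smul {b : ℝ} (hb : 0 < b) (x : EuclideanSpace ℂ (Fin M)) :
    unitVec ((b : ℂ) • x) = unitVec x := by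
  have hb' : (b : ℂ) ≠ 0 := by exact_mod_cast hb.ne'
  rw [unitVec, unitVec, norm_smul, Complex.norm_real, Real.norm_of_nonneg hb.le, smul_smul]
  congr 1
  push_cast
  rw [mul_inv, mul_right_comm, inv_mul_cancel₀ hb', one_mul]

theorem norm_sq_inner_unitVec_smul (c : ℂ) (x : EuclideanSpace ℂ (Fin M)) :
    ‖inner ℂ (unitVec x) (c • x)‖ ^ 2 = ‖c‖ ^ 2 * ‖x‖ ^ 2 := by
  by_cases hx : x = 0
  · simp [hx]
  have hx' := norm_ne_zero_iff.2 hx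
  rw [unitVec, inner_smul_left, inner_smul_right, inner_self_eq_norm_sq_to_K, norm_mul, norm_mul,
    RCLike.norm_conj, norm_inv, Complex.norm_real, norm_norm, norm_pow]
  simp only [Complex.coe_algebraMap, Complex.norm_real, norm_norm]
  field_simp

/-- Here `1/γ = (B + D² (Q/p)) / a` almost surely, and Jensen's inequality applies to this ratio. In
use, `p = ‖y‖²`, `m = M - 1`, and `I`, `K` bound the mean contamination and interference. -/
theorem ofReal_log_le_lintegral_of_ratio {Ω : Type*} [MeasurableSpace Ω] {μ : Measure Ω}
    [IsProbabilityMeasure μ] {γ B Q p : Ω → ℝ} {a D I K m : ℝ} (ha : 0 < a) (hD : 0 < D) (hI : 0 ≤ I)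
    (hK : 0 < K) (hm : 0 < m) (hB : Measurable B) (hQ : Measurable Q) (hp : Measurable p)
    (hB0 : ∀ ω, 0 ≤ B ω) (hQ0 : ∀ᵐ ω ∂μ, 0 < Q ω) (hp0 : ∀ᵐ ω ∂μ, 0 < p ω)
    (hBI : ∫⁻ ω, ENNReal.ofReal (B ω) ∂μ ≤ ENNReal.ofReal I)
    (hQK : ∫⁻ ω, ENNReal.ofReal (Q ω / p ω) ∂μ ≤ ENNReal.ofReal (K * (1 / (D * m))))
    (hγ : ∀ᵐ ω ∂μ, γ ω = a * (p ω / D ^ 2) / (B ω * (p ω / D ^ 2) + Q ω)) :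
    ENNReal.ofReal (Real.log (1 + m * a / (m * I + K * D)))
      ≤ ∫⁻ ω, ENNReal.ofReal (Real.log (1 + γ ω)) ∂μ := by
  have hmm : 0 < (I + D ^ 2 * (K * (1 / (D * m)))) / a := by positivity
  have e : m * a / (m * I + K * D) = 1 / ((I + D ^ 2 * (K * (1 / (D * m)))) / a) := by
    field_simp
  rw [e]
  refine (ofReal_log_le_lintegral (R := fun ω => (B ω + D ^ 2 * (Q ω / p ω)) / a) hmm
    (by fun_prop) ?_ ?_).trans (lintegral_mono_ae ?_)
  · filter_upwards [hQ0, hp0] with ω h1 h2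
    have := hB0 ω
    positivity
  · calc ∫⁻ ω, ENNReal.ofReal ((B ω + D ^ 2 * (Q ω / p ω)) / a) ∂μ
        = ∫⁻ ω, ENNReal.ofReal a⁻¹ * (ENNReal.ofReal (B ω)
            + ENNReal.ofReal (D ^ 2) * ENNReal.ofReal (Q ω / p ω)) ∂μ := by
          refine lintegral_congr_ae ?_
          filter_upwards [hQ0, hp0] with ω h1 h2
          rw [← ENNReal.ofReal_mul (by positivity),
            ← ENNReal.ofReal_add (hB0 ω) (by positivity), ← ENNReal.ofReal_mul (by positivity),
            div_eq_inv_mul]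
      _ = ENNReal.ofReal a⁻¹ * (∫⁻ ω, ENNReal.ofReal (B ω) ∂μ
            + ENNReal.ofReal (D ^ 2) * ∫⁻ ω, ENNReal.ofReal (Q ω / p ω) ∂μ) := by
          rw [lintegral_const_mul' _ _ ENNReal.ofReal_ne_top,
            lintegral_add_left hB.ennreal_ofReal, lintegral_const_mul' _ _ ENNReal.ofReal_ne_top]
      _ ≤ ENNReal.ofReal a⁻¹ * (ENNReal.ofReal I
            + ENNReal.ofReal (D ^ 2) * ENNReal.ofReal (K * (1 / (D * m)))) := by gcongr
      _ = ENNReal.ofReal ((I + D ^ 2 * (K * (1 / (D * m)))) / a) := by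
          rw [← ENNReal.ofReal_mul (by positivity),
            ← ENNReal.ofReal_add hI (by positivity), ← ENNReal.ofReal_mul (by positivity),
            inv_mul_eq_div]
  · filter_upwards [hQ0, hp0, hγ] with ω h1 h2 h3
    have := hB0 ω
    have h4 : 0 < B ω * p ω + D ^ 2 * Q ω := by positivity
    have e2 : γ ω = 1 / ((B ω + D ^ 2 * (Q ω / p ω)) / a) := by
      rw [h3]
      field_simp
    rw [e2]

namespace Network

variable (N : Network C NG M τ) (d : Fin NG → ℕ) (l : Fin C) (k : Fin NG)

/-- `β ≤ D` and `ρ^(2d) ≤ 1`, so the estimate removes at most `β² / D ≤ β`. -/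
theorem vVar_nonneg (kc : Fin NG × Fin C) : 0 ≤ N.vVar d l k kc := by
  rw [vVar]
  split_ifs
  · have h1 : N.β l k kc.2 ≤ N.yVar l k := by
      have h2 := Finset.single_le_sum (f := fun b => N.β l k b)
        (fun b _ => (N.β_pos l k b).le) (Finset.mem_univ kc.2)
      have h3 : 0 < 1 / N.Pp := one_div_pos.2 N.Pp_pos
      rw [yVar]
      linarith
    have h2 := N.β_pos l k kc.2
    have h3 := N.yVar_pos l k
    have h4 : N.ρ l k kc.2 ^ (2 * d k) ≤ 1 := by
      rw [pow_mul]
      exact pow_le_one₀ (sq_nonneg _) ((sq_le_one_iff_abs_le_one _).2 (N.abs_ρ_le_one l k kc.2))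
    have h5 : N.β l k kc.2 ^ 2 / N.yVar l k ≤ N.β l k kc.2 := by
      rw [div_le_iff₀ h3, pow_two]
      gcongr
    have h6 : 0 ≤ N.β l k kc.2 ^ 2 / N.yVar l k := by positivity
    nlinarith
  · exact (N.β_pos _ _ _).le

theorem sum_vVar_pos : 0 < ∑ kc, N.vVar d l k kc + 1 / N.Pu := by
  have h1 : 0 < 1 / N.Pu := one_div_pos.2 N.Pu_pos
  have h2 : 0 ≤ ∑ kc, N.vVar d l k kc := Finset.sum_nonneg fun kc _ => N.vVar_nonneg d l k kc
  linarith

theorem In_eq : N.In d l k = (∑ kc, N.vVar d l k kc + 1 / N.Pu) * N.yVar l k := by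
  rw [In, ← yVar, Fintype.sum_prod_type, ← Finset.add_sum_erase _ _ (Finset.mem_univ k),
    Finset.sum_comm (s := Finset.univ) (t := Finset.univ.erase k)]
  congr 2
  rw [add_comm]
  congr 1
  · exact Finset.sum_congr rfl fun c _ => by rw [vVar, if_pos rfl]
  · refine Finset.sum_congr rfl fun k' hk' => Finset.sum_congr rfl fun c _ => ?_
    rw [vVar, if_neg (Finset.ne_of_mem_erase hk')]

theorem Ip_nonneg : 0 ≤ N.Ip d l k :=
  Finset.sum_nonneg fun c _ => by rw [pow_mul]; positivity

theorem In_pos : 0 < N.In d l k := by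
  rw [In_eq]
  exact mul_pos (N.sum_vVar_pos d l k) (N.yVar_pos l k)

end Network

/-! ### Both senses of the SINR. -/

namespace Model

variable {N : Network C NG M τ} {Ω : Type*} [MeasurableSpace Ω] {μ : Measure Ω} (X : Model N μ)

/-- The symbol that reaches the receiver along with the pilot contamination. -/
def contamination (d : Fin NG → ℕ) (l : Fin C) (k : Fin NG) (ω : Ω) : ℂ :=
  ∑ c, X.S k c ω * (if c = l then 0 else ((N.ρ l k c ^ d k * N.β l k c : ℝ) : ℂ))

theorem measurable_contamination (d : Fin NG → ℕ) (l : Fin C) (k : Fin NG) :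
    Measurable (X.contamination d l k) :=
  Finset.measurable_fun_sum _ fun c _ => (X.measurable_S k c).mul_const _

theorem memLp_and_integral_norm_sq_contamination [IsProbabilityMeasure μ] (d : Fin NG → ℕ)
    (l : Fin C) (k : Fin NG) : MemLp (X.contamination d l k) 2 μ ∧
      ∫ ω, ‖X.contamination d l k ω‖ ^ 2 ∂μ = N.Ip d l k := by
  have h1 := memLp_and_integral_norm_sq_sum_mul_add (μ := μ) (S := X.S k)
    (v := fun c _ => if c = l then 0 else ((N.ρ l k c ^ d k * N.β l k c : ℝ) : ℂ))
    (w := fun _ => 0) (X.memLp_S k) (fun c => memLp_const _) (memLp_const _)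
    (indepFun_const_right _ _) (fun c c' => by rw [X.symbol_corr]; simp) (by simp)
  simp only [add_zero] at h1
  refine ⟨h1.1, h1.2.trans ?_⟩
  simp only [integral_const, probReal_univ, one_smul, norm_zero, ne_eq, OfNat.ofNat_ne_zero,
    not_false_eq_true, zero_pow, smul_zero, add_zero]
  rw [Network.Ip, ← Finset.add_sum_erase _ _ (Finset.mem_univ l), if_pos rfl, norm_zero,
    zero_pow two_ne_zero, zero_add]
  refine Finset.sum_congr rfl fun c hc => ?_
  rw [if_neg (Finset.ne_of_mem_erase hc), Complex.norm_real, Real.norm_eq_abs, sq_abs, mul_pow,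
    ← pow_mul, mul_comm (d k)]

variable {t : ℕ} {d : Fin NG → ℕ}

/-- Normalization cancels the positive factor `β / D`. -/
theorem u_eq (hd : N.IsCSIDelay t d) (l : Fin C) (k : Fin NG) (ω : Ω) :
    X.u t d l k ω = unitVec (X.y l k (t - d k) ω) := by
  rw [u, ← unitVec, X.gHat_eq l l (hd k).2.1,
    unitVec_smul (div_pos (N.β_pos l k l) (N.yVar_pos l k))]

theorem norm_sq_inner_I₁ (hd : N.IsCSIDelay t d) (l : Fin C) (k : Fin NG) (ω : Ω)
    (σ : Fin NG → Fin C → ℂ) : ‖inner ℂ (X.u t d l k ω) (X.I₁ t d l k ω σ)‖ ^ 2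
      = N.β l k l ^ 2 * N.ρ l k l ^ (2 * d k) * (‖X.y l k (t - d k) ω‖ ^ 2 / N.yVar l k ^ 2)
        * ‖σ k l‖ ^ 2 := by
  rw [X.u_eq hd, I₁, X.gHat_eq l l (hd k).2.1, smul_smul, norm_sq_inner_unitVec_smul, norm_mul,
    norm_mul, norm_pow, Complex.norm_real, Complex.norm_real, Real.norm_eq_abs, Real.norm_eq_abs,
    mul_pow, mul_pow, sq_abs, ← pow_mul, mul_comm (d k), pow_mul, sq_abs, pow_mul, div_pow]
  ring

theorem norm_sq_inner_I₂ (hd : N.IsCSIDelay t d) (l : Fin C) (k : Fin NG) (ω ω' : Ω) :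
    ‖inner ℂ (X.u t d l k ω) (X.I₂ t d l k ω (X.symbols ω'))‖ ^ 2
      = ‖X.contamination d l k ω'‖ ^ 2 * (‖X.y l k (t - d k) ω‖ ^ 2 / N.yVar l k ^ 2) := by
  have e : X.I₂ t d l k ω (X.symbols ω')
      = (X.contamination d l k ω' * ((N.yVar l k)⁻¹ : ℝ)) • X.y l k (t - d k) ω := by
    rw [I₂, contamination, ← Finset.add_sum_erase _ _ (Finset.mem_univ l), if_pos rfl, mul_zero,
      zero_add, Finset.sum_mul, Finset.sum_smul]
    refine Finset.sum_congr rfl fun c hc => ?_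
    rw [X.gHat_eq l c (hd k).2.1, smul_smul, if_neg (Finset.ne_of_mem_erase hc)]
    congr 1
    rw [symbols]
    push_cast
    ring
  rw [X.u_eq hd, e, norm_sq_inner_unitVec_smul, norm_mul, Complex.norm_real, Real.norm_eq_abs,
    mul_pow, sq_abs]
  ring

theorem seBound_term_le_of_ratio [IsProbabilityMeasure μ] (hM : 2 ≤ M) (hd : N.IsCSIDelay t d)
    (l : Fin C) (k : Fin NG) (hρ : N.ρ l k l ^ (2 * d k) ≠ 0) {γ B Q : Ω → ℝ} (hB : Measurable B)
    (hQ : Measurable Q) (hB0 : ∀ ω, 0 ≤ B ω) (hQ0 : ∀ᵐ ω ∂μ, 0 < Q ω)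
    (hBI : ∫⁻ ω, ENNReal.ofReal (B ω) ∂μ ≤ ENNReal.ofReal (N.Ip d l k))
    (hQK : ∫⁻ ω, ENNReal.ofReal (Q ω / ‖X.y l k (t - d k) ω‖ ^ 2) ∂μ
      ≤ ENNReal.ofReal ((∑ kc, N.vVar d l k kc + 1 / N.Pu) * (1 / (N.yVar l k * (M - 1)))))
    (hγ : ∀ᵐ ω ∂μ, γ ω = N.β l k l ^ 2 * N.ρ l k l ^ (2 * d k)
        * (‖X.y l k (t - d k) ω‖ ^ 2 / N.yVar l k ^ 2)
      / (B ω * (‖X.y l k (t - d k) ω‖ ^ 2 / N.yVar l k ^ 2) + Q ω)) :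
    ENNReal.ofReal (Real.log (1 + (((M : ℝ) - 1) * N.β l k l ^ 2 * N.ρ l k l ^ (2 * d k)) /
      (((M : ℝ) - 1) * N.Ip d l k + N.In d l k)))
      ≤ ∫⁻ ω, ENNReal.ofReal (Real.log (1 + γ ω)) ∂μ := by
  have hM' : (2 : ℝ) ≤ M := by exact_mod_cast hM
  have hρ' : 0 < N.ρ l k l ^ (2 * d k) := lt_of_le_of_ne (by rw [pow_mul]; positivity) hρ.symm
  have hβ := N.β_pos l k l
  have hy := X.measurable_y l k (t - d k)
  rw [N.In_eq, mul_assoc ((M : ℝ) - 1) (N.β l k l ^ 2)]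
  refine ofReal_log_le_lintegral_of_ratio (by positivity) (N.yVar_pos l k) (N.Ip_nonneg d l k)
    (N.sum_vVar_pos d l k) (by linarith) hB hQ (by fun_prop) hB0 hQ0 ?_ hBI hQK hγ
  filter_upwards [X.ae_y_ne_zero (by omega) l (hd k).2.1] with ω hω
  have := norm_pos_iff.2 hω
  positivity

theorem measurable_inner_I₃_arg :
    Measurable fun p : EuclideanSpace ℂ (Fin M) × (Fin NG × Fin C → ℂ) ×
      (Fin NG × Fin C → EuclideanSpace ℂ (Fin M)) × EuclideanSpace ℂ (Fin M) =>
      (inner ℂ (unitVec p.1) (∑ kc, p.2.1 kc • p.2.2.1 kc + (√N.Pu : ℂ)⁻¹ • p.2.2.2) : ℂ) := by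
  have := measurable_unitVec (M := M)
  fun_prop

theorem seBound_term_le_sinrPower [IsProbabilityMeasure μ] (hM : 2 ≤ M) (hd : N.IsCSIDelay t d)
    (l : Fin C) (k : Fin NG) (hρ : N.ρ l k l ^ (2 * d k) ≠ 0) :
    ENNReal.ofReal (Real.log (1 + (((M : ℝ) - 1) * N.β l k l ^ 2 * N.ρ l k l ^ (2 * d k)) /
      (((M : ℝ) - 1) * N.Ip d l k + N.In d l k)))
      ≤ ∫⁻ ω, ENNReal.ofReal (Real.log (1 + X.sinrPower t d l k ω)) ∂μ := by
  have hu := measurable_unitVec (M := M)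
  have hy := X.measurable_y l k (t - d k)
  have hv := X.measurable_v t d l k
  have hPu : 0 < 1 / N.Pu := one_div_pos.2 N.Pu_pos
  have hI₃ : ∀ ω, ∫ ω', ‖inner ℂ (X.u t d l k ω)
      (X.I₃ t d l k ω (X.symbols ω') (X.Wu l ω'))‖ ^ 2 ∂μ
      = ∑ kc, ‖inner ℂ (unitVec (X.y l k (t - d k) ω)) (X.v t d l k kc ω)‖ ^ 2
        + ‖unitVec (X.y l k (t - d k) ω)‖ ^ 2 * (1 / N.Pu) := by
    intro ω
    rw [← X.integral_norm_sq_inner_symbols_noise l _ fun kc => X.v t d l k kc ω]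
    simp_rw [X.I₃_eq hd, X.u_eq hd]
    rfl
  refine X.seBound_term_le_of_ratio hM hd l k hρ (B := fun _ => N.Ip d l k)
    (Q := fun ω => ∑ kc, ‖inner ℂ (unitVec (X.y l k (t - d k) ω)) (X.v t d l k kc ω)‖ ^ 2
        + ‖unitVec (X.y l k (t - d k) ω)‖ ^ 2 * (1 / N.Pu)) measurable_const (by fun_prop)
    (fun _ => N.Ip_nonneg d l k) ?_ (by simp) ?_ ?_
  · filter_upwards [X.ae_y_ne_zero (by omega) l (hd k).2.1] with ω hω
    rw [norm_unitVec hω]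
    positivity
  · refine X.lintegral_div_norm_sq_y_le hM l (hd k).2.1
      -- The noise component of `V` is not read by `Q`; it is carried to match `indepFun_y`.
      (V := fun ω => ((fun kc => X.v t d l k kc ω), X.Wu l ω))
      ((measurable_pi_lambda _ hv).prodMk (X.measurable_Wu l)) (X.indepFun_y hd l k)
      (Q := fun x f => ∑ kc, ‖inner ℂ (unitVec x) (f.1 kc)‖ ^ 2 + ‖unitVec x‖ ^ 2 * (1 / N.Pu))
      (by simp only [Function.uncurry_def]; fun_prop) (fun x f => by positivity)
      (N.sum_vVar_pos d l k).le fun x => ?_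
    have hi : ∀ kc, Integrable (fun ω => ‖inner ℂ (unitVec x) (X.v t d l k kc ω)‖ ^ 2) μ := by
      intro kc
      simp_rw [inner_v]
      exact MemLp.integrable_norm_sq (X.isGaussianSources.memLp_lin _)
    rw [← ofReal_integral_eq_lintegral_ofReal (f := fun ω =>
        ∑ kc, ‖inner ℂ (unitVec x) (X.v t d l k kc ω)‖ ^ 2 + ‖unitVec x‖ ^ 2 * (1 / N.Pu))
      ((integrable_finsetSum _ fun kc _ => hi kc).add (integrable_const _))
      (.of_forall fun ω => by positivity)]
    apply ENNReal.ofReal_le_ofReal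
    have hsum : ∀ kc, ∫ ω, ‖inner ℂ (unitVec x) (X.v t d l k kc ω)‖ ^ 2 ∂μ
        = ‖unitVec x‖ ^ 2 * N.vVar d l k kc := by
      intro kc
      simp_rw [inner_v]
      exact X.isGaussianSources.integral_norm_sq_lin _
        (covar_innerCoef _ _ (Network.covar_vCoef hd l k kc))
    rw [integral_add (integrable_finsetSum _ fun kc _ => hi kc) (integrable_const _),
      integral_finsetSum _ fun kc _ => hi kc]
    simp_rw [hsum]
    rw [integral_const, probReal_univ, one_smul, ← Finset.mul_sum, ← mul_add]
    exact mul_le_of_le_one_left (N.sum_vVar_pos d l k).le (norm_sq_unitVec_le x)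
  · refine .of_forall fun ω => ?_
    rw [sinrPower, hI₃]
    simp_rw [X.norm_sq_inner_I₁ hd, X.norm_sq_inner_I₂ hd]
    rw [integral_const_mul, integral_mul_const, (X.memLp_and_integral_norm_sq_contamination d l k).2]
    have := X.integral_norm_sq_S k l
    simp only [symbols, this, mul_one]

theorem seBound_term_le_sinr [IsProbabilityMeasure μ] (hM : 2 ≤ M) (hd : N.IsCSIDelay t d)
    (hS : ∀ k c, ∀ᵐ ω ∂μ, ‖X.S k c ω‖ = 1)
    (l : Fin C) (k : Fin NG) (hρ : N.ρ l k l ^ (2 * d k) ≠ 0) :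
    ENNReal.ofReal (Real.log (1 + (((M : ℝ) - 1) * N.β l k l ^ 2 * N.ρ l k l ^ (2 * d k)) /
      (((M : ℝ) - 1) * N.Ip d l k + N.In d l k)))
      ≤ ∫⁻ ω, ENNReal.ofReal (Real.log (1 + X.sinr t d l k ω)) ∂μ := by
  have hu := measurable_unitVec (M := M)
  have hy := X.measurable_y l k (t - d k)
  have hv := X.measurable_v t d l k
  have hSm : Measurable fun ω (kc : Fin NG × Fin C) => X.S kc.1 kc.2 ω :=
    measurable_pi_lambda _ fun kc => X.measurable_S _ _
  have hV : Measurable fun ω => ((fun kc : Fin NG × Fin C => X.S kc.1 kc.2 ω),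
      (fun kc => X.v t d l k kc ω), X.Wu l ω) :=
    hSm.prodMk ((measurable_pi_lambda _ hv).prodMk (X.measurable_Wu l))
  have hT := X.memLp_and_integral_norm_sq_contamination d l k
  have hTm := X.measurable_contamination d l k
  have hJ := measurable_inner_I₃_arg (N := N)
  have hI₃ : ∀ ω, inner ℂ (X.u t d l k ω) (X.I₃ t d l k ω (X.symbols ω) (X.Wu l ω))
      = inner ℂ (unitVec (X.y l k (t - d k) ω)) (∑ kc : Fin NG × Fin C,
        X.S kc.1 kc.2 ω • X.v t d l k kc ω + (√N.Pu : ℂ)⁻¹ • X.Wu l ω) := by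
    intro ω
    rw [X.I₃_eq hd, X.u_eq hd]
    rfl
  refine X.seBound_term_le_of_ratio hM hd l k hρ (B := fun ω => ‖X.contamination d l k ω‖ ^ 2)
    (Q := fun ω => ‖inner ℂ (unitVec (X.y l k (t - d k) ω)) (∑ kc : Fin NG × Fin C,
        X.S kc.1 kc.2 ω • X.v t d l k kc ω + (√N.Pu : ℂ)⁻¹ • X.Wu l ω)‖ ^ 2) (by fun_prop)
    ((hJ.comp (hy.prodMk hV)).norm.pow_const 2)
    (fun _ => sq_nonneg _) ?_ ?_ ?_ ?_
  -- The implication excludes `y = 0`, where the receiver vanishes; this lets the null-set argument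
  -- freeze any value of `y`.
  · have hs : MeasurableSet {p : EuclideanSpace ℂ (Fin M) × (Fin NG × Fin C → ℂ) ×
        (Fin NG × Fin C → EuclideanSpace ℂ (Fin M)) × EuclideanSpace ℂ (Fin M) | p.1 ≠ 0 →
        (inner ℂ (unitVec p.1) (∑ kc, p.2.1 kc • p.2.2.1 kc + (√N.Pu : ℂ)⁻¹ • p.2.2.2) : ℂ) ≠ 0} :=
      (measurableSet_eq_fun (by fun_prop) measurable_const).compl.imp
        (measurableSet_eq_fun hJ measurable_const).compl
    have h1 := ae_mem_of_indepFun hy hV (X.indepFun_y_symbols hd l k) hs fun x => by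
      by_cases hx : x = 0
      · exact .of_forall fun ω h => absurd hx h
      · have hx' : unitVec x ≠ 0 := norm_ne_zero_iff.1 (by rw [norm_unitVec hx]; exact one_ne_zero)
        filter_upwards [X.ae_inner_ne_zero t d l k hx'] with ω hω _ using hω
    filter_upwards [h1, X.ae_y_ne_zero (by omega) l (hd k).2.1] with ω h2 h3
    exact pow_pos (norm_pos_iff.2 (h2 h3)) 2
  · rw [← ofReal_integral_eq_lintegral_ofReal (MemLp.integrable_norm_sq hT.1)
      (.of_forall fun _ => sq_nonneg _), hT.2]
  · refine X.lintegral_div_norm_sq_y_le hM l (hd k).2.1 hV (X.indepFun_y_symbols hd l k)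
      (Q := fun x f => ‖inner ℂ (unitVec x) (∑ kc, f.1 kc • f.2.1 kc
        + (√N.Pu : ℂ)⁻¹ • f.2.2)‖ ^ 2)
      (hJ.norm.pow_const 2) (fun x f => sq_nonneg _)
      (N.sum_vVar_pos d l k).le fun x => ?_
    have h1 := X.memLp_and_integral_norm_sq_inner hd l k (unitVec x)
    rw [← ofReal_integral_eq_lintegral_ofReal (MemLp.integrable_norm_sq h1.1)
      (.of_forall fun _ => sq_nonneg _), h1.2]
    exact ENNReal.ofReal_le_ofReal
      (mul_le_of_le_one_left (N.sum_vVar_pos d l k).le (norm_sq_unitVec_le x))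
  -- Constant modulus enters only here, to set `|S|² = 1` in the numerator.
  · filter_upwards [hS k l] with ω hω
    rw [sinr, X.norm_sq_inner_I₁ hd, X.norm_sq_inner_I₂ hd, hI₃]
    simp only [symbols, hω, one_pow, mul_one]

theorem seBound_le_averageSE [IsProbabilityMeasure μ] {γ : Fin C → Fin NG → Ω → ℝ}
    (hM : 1 ≤ M) (h : ∀ l k, 2 ≤ M → N.ρ l k l ^ (2 * d k) ≠ 0 →
      ENNReal.ofReal (Real.log (1 + (((M : ℝ) - 1) * N.β l k l ^ 2 * N.ρ l k l ^ (2 * d k)) /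
        (((M : ℝ) - 1) * N.Ip d l k + N.In d l k)))
        ≤ ∫⁻ ω, ENNReal.ofReal (Real.log (1 + γ l k ω)) ∂μ) :
    ENNReal.ofReal (N.seBound d) ≤ X.averageSE γ := by
  have hc : 0 ≤ 1 - τ / N.Ts := by
    rw [sub_nonneg, div_le_one N.Ts_pos]
    exact N.τ_le_Ts
  have hM' : (0 : ℝ) ≤ M - 1 := by
    rw [sub_nonneg]
    exact_mod_cast hM
  have hρ : ∀ l k, 0 ≤ N.ρ l k l ^ (2 * d k) := fun l k => by rw [pow_mul]; positivity
  have hnn : ∀ l k, 0 ≤ (1 - τ / N.Ts) * Real.log (1 +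
      (((M : ℝ) - 1) * N.β l k l ^ 2 * N.ρ l k l ^ (2 * d k)) /
      (((M : ℝ) - 1) * N.Ip d l k + N.In d l k)) := by
    intro l k
    refine mul_nonneg hc (Real.log_nonneg (le_add_of_nonneg_right ?_))
    have := N.Ip_nonneg d l k
    have := N.In_pos d l k
    have := hρ l k
    positivity
  rw [Network.seBound, averageSE,
    ENNReal.ofReal_sum_of_nonneg fun l _ => Finset.sum_nonneg fun k _ => hnn l k]
  refine Finset.sum_le_sum fun l _ => ?_
  rw [ENNReal.ofReal_sum_of_nonneg fun k _ => hnn l k]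
  refine Finset.sum_le_sum fun k _ => ?_
  simp_rw [ENNReal.ofReal_mul hc]
  rw [lintegral_const_mul' _ _ ENNReal.ofReal_ne_top]
  gcongr
  -- With one antenna or vanishing correlation the claimed rate is `log 1 = 0`, so nothing is
  -- needed.
  by_cases h0 : 2 ≤ M ∧ N.ρ l k l ^ (2 * d k) ≠ 0
  · exact h l k h0.1 h0.2
  · have h1 : ((M : ℝ) - 1) * N.β l k l ^ 2 * N.ρ l k l ^ (2 * d k) = 0 := by
      by_cases hM2 : 2 ≤ M
      · have : N.ρ l k l ^ (2 * d k) = 0 := by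
          by_contra h2
          exact h0 ⟨hM2, h2⟩
        rw [this, mul_zero]
      · have : M = 1 := by omega
        simp [this]
    simp [h1]

end Model

end

end CopilotUplink

end

theorem theorem1 {C NG M τ : ℕ} (hM : 1 ≤ M) (N : CopilotUplink.Network C NG M τ)
    {Ω : Type*} [MeasurableSpace Ω] (μ : MeasureTheory.Measure Ω)
    [MeasureTheory.IsProbabilityMeasure μ] (X : CopilotUplink.Model N μ)
    (t : ℕ) (d : Fin NG → ℕ) (hd : N.IsCSIDelay t d) :
    ENNReal.ofReal (N.seBound d) ≤ X.averageSE (X.sinrPower t d) ∧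
      ((∀ k c, ∀ᵐ ω ∂μ, ‖X.S k c ω‖ = 1) →
        ENNReal.ofReal (N.seBound d) ≤ X.averageSE (X.sinr t d)) :=
  ⟨X.seBound_le_averageSE hM fun l k hM2 hρ => X.seBound_term_le_sinrPower hM2 hd l k hρ,
    fun hS => X.seBound_le_averageSE hM fun l k hM2 hρ =>
      X.seBound_term_le_sinr hM2 hd hS l k hρ⟩
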